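/- Let $R$ be a commutative noetherian ring, let $\mathfrak a=(x_1,\dots,x_r)$ be an ideal of $R$, let $n\ge 1$ be an integer, and let $M$ be an $R$-module (not necessarily finitely generated). Write $H^i_{\mathfrak a}(M)=\varinjlim_t \operatorname{Ext}^i_R(R/\mathfrak a^t,M)$ for the local cohomology modules of $M$ with support in $\mathfrak a$, and $H^i(x_1,\dots,x_r;M)$ for the Koszul cohomology modules, i.e. the cohomology of $\operatorname{Hom}_R(K_\bullet(x_1,\dots,x_r),M)$. An $R$-module $N$ is called $\mathfrak a$-cofinite if $\operatorname{Supp}_R(N)\subseteq V(\mathfrak a)$ and $\operatorname{Ext}^i_R(R/\mathfrak a,N)$ is finitely generated for every $i\ge 0$. An element $y\in R$ is filter-regular on $N$ if $0:_N y$ has finite length, and a sequence $y_1,\dots,y_s$ in $R$ is filter-regular on $N$ if $y_j$ is filter-regular on $N/(y_1,\dots,y_{j-1})N$ for $j=1,\dots,s$. Then the following conditions are equivalent: (i) $H^i_{\mathfrak a}(M)$ is artinian and $\mathfrak a$-cofinite for all $i<n$; (ii) $\operatorname{Ext}^i_R(R/\mathfrak a,M)$ has finite length for all $i<n$; (iii)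 $H^i(x_1,\dots,x_r;M)$ has finite length for all $i<n$. If $M$ is finitely generated, these conditions are also equivalent to each of: (iv) $H^i_{\mathfrak a}(M)$ is artinian for all $i<n$; (v) there is a sequence of length $n$ of elements of $\mathfrak a$ that is filter-regular on $M$. -/

import Mathlib

open CategoryTheory

universe u

noncomputable section

namespace ArtCof

section Koszul

variable {R : Type u} [CommRing R] {r : ℕ}

/-- The sign of `s` in `S`, i.e. `(-1) ^ #{t ∈ S | t < s}`. -/
def koszulSign (S : Finset (Fin r)) (s : Fin r) : ℤ :=
  (-1) ^ (S.filter (· < s)).card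

/-- Removing two elements of `S` in the two possible orders gives opposite signs. -/
lemma koszulSign_swap (S : Finset (Fin r)) {s t : Fin r} (hs : s ∈ S) (ht : t ∈ S) (hst : s ≠ t) :
    koszulSign S s * koszulSign (S.erase s) t + koszulSign S t * koszulSign (S.erase t) s = 0 := by
  wlog h : s < t generalizing s t
  · rw [add_comm]
    exact this ht hs hst.symm (lt_of_le_of_ne (not_lt.mp h) hst.symm)
  have h1 : (S.erase t).filter (· < s) = S.filter (· < s) := by
    ext k
    simp only [Finset.mem_filter, Finset.mem_erase]
    refine ⟨fun hk => ⟨hk.1.2, hk.2⟩, fun hk => ⟨⟨(hk.2.trans h).ne, hk.1⟩, hk.2⟩⟩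
  have h2 : (S.filter (· < t)).card = ((S.erase s).filter (· < t)).card + 1 := by
    rw [Finset.filter_erase, Finset.card_erase_add_one]
    exact Finset.mem_filter.mpr ⟨hs, h⟩
  simp only [koszulSign, h1, h2, pow_succ]
  ring

variable (x : Fin r → R) (M : Type u) [AddCommGroup M] [Module R M]

/-- The Koszul cochains of degree `i` with values in `M`. The set `S = {s₁ < ⋯ < sᵢ}` stands for
the basis element `e_{s₁} ∧ ⋯ ∧ e_{sᵢ}` of `⋀ⁱ Rʳ`, so this is `Hom_R (⋀ⁱ Rʳ, M)`. -/
abbrev KoszulCochain (r : ℕ) (M : Type u) (i : ℕ) : Type u :=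
  {S : Finset (Fin r) // S.card = i} → M

/-- The Koszul differential
`(d φ)(S) = ∑_{s ∈ S} (-1) ^ #{t ∈ S | t < s} x_s φ(S \ {s})`. -/
def koszulD (i : ℕ) : KoszulCochain r M i →ₗ[R] KoszulCochain r M (i + 1) where
  toFun φ S := ∑ s : {s // s ∈ S.1},
    koszulSign S.1 s.1 • x s.1 •
      φ ⟨S.1.erase s.1, by rw [Finset.card_erase_of_mem s.2, S.2, Nat.add_sub_cancel]⟩
  map_add' φ ψ := by
    funext S
    simp [Finset.sum_add_distrib]
  map_smul' c φ := by
    funext S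
    simp only [Pi.smul_apply, RingHom.id_apply, Finset.smul_sum]
    refine Finset.sum_congr rfl fun s _ => ?_
    rw [smul_comm (x s.1) c, smul_comm (koszulSign S.1 s.1) c]

lemma koszulD_comp_koszulD (i : ℕ) : koszulD x M (i + 1) ∘ₗ koszulD x M i = 0 := by
  refine LinearMap.ext fun φ => funext fun S => ?_
  simp only [koszulD, LinearMap.comp_apply, LinearMap.coe_mk, AddHom.coe_mk, LinearMap.zero_apply,
    Pi.zero_apply, Finset.smul_sum]
  rw [Finset.sum_sigma']
  refine Finset.sum_involution
    (fun p _ => ⟨⟨p.2.1, Finset.mem_of_mem_erase p.2.2⟩,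
      ⟨p.1.1, Finset.mem_erase.mpr ⟨(Finset.ne_of_mem_erase p.2.2).symm, p.1.2⟩⟩⟩) ?_ ?_ ?_ ?_
  · rintro ⟨⟨s, hs⟩, ⟨t, ht⟩⟩ -
    have ht' := Finset.mem_erase.mp ht
    have key := koszulSign_swap S.1 hs ht'.2 (Ne.symm ht'.1)
    have e : (S.1.erase t).erase s = (S.1.erase s).erase t := Finset.erase_right_comm
    simp only [e]
    generalize φ _ = m
    have : ∀ (a b : ℤ) (p q : R), a • p • b • q • m = (a * b) • (p * q) • m := by
      intro a b p q
      rw [smul_comm p b, smul_smul a b, smul_smul p q]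
    rw [this, this, mul_comm (x t) (x s), ← add_smul, key, zero_smul]
  · rintro ⟨⟨s, hs⟩, ⟨t, ht⟩⟩ - - h
    have ht' := Finset.mem_erase.mp ht
    exact ht'.1 (congrArg (fun p => p.1.1) h)
  · simp
  · rintro ⟨⟨s, hs⟩, ⟨t, ht⟩⟩ -
    rfl

/-- The Koszul cochain complex `Hom_R (K_•(x₁, …, x_r), M)`. -/
def koszulComplex : CochainComplex (ModuleCat.{u} R) ℕ :=
  CochainComplex.of (fun i => ModuleCat.of R (KoszulCochain r M i))
    (fun i => ModuleCat.ofHom (koszulD x M i))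
    (fun i => by rw [← ModuleCat.ofHom_comp, koszulD_comp_koszulD]; rfl)

/-- The Koszul cohomology module `Hⁱ(x₁, …, x_r; M)`. -/
def koszulCohomology (i : ℕ) : ModuleCat.{u} R :=
  (koszulComplex x M).homology i

end Koszul

variable {R : Type u} [CommRing R]

/-- The module `Extⁱ_R(R/𝔞, M)`. -/
abbrev ExtQuot (𝔞 : Ideal R) (M : Type u) [AddCommGroup M] [Module R M] (i : ℕ) : Type u :=
  Abelian.Ext.{u} (ModuleCat.of R (R ⧸ 𝔞)) (ModuleCat.of R M) i

/-- `M` is `𝔞`-cofinite: `Supp M ⊆ V(𝔞)` and `Extⁱ_R(R/𝔞, M)` is finitely generated for all `i`. -/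
def IsCofinite (𝔞 : Ideal R) (M : Type u) [AddCommGroup M] [Module R M] : Prop :=
  Module.support R M ⊆ PrimeSpectrum.zeroLocus (𝔞 : Set R) ∧
    ∀ i : ℕ, Module.Finite R (ExtQuot 𝔞 M i)

/-- The element `y` is filter-regular on `M`: the module `0 :_M y` has finite length. -/
def IsFilterRegular (M : Type u) [AddCommGroup M] [Module R M] (y : R) : Prop :=
  IsFiniteLength R (Submodule.torsionBy R M y)

/-- The sequence `y` is filter-regular on `M`: each `y j` is filter-regular on the quotient of `M`
by the submodule generated by the multiples of the preceding terms. -/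
def IsFilterRegularSeq (M : Type u) [AddCommGroup M] [Module R M] {n : ℕ} (y : Fin n → R) : Prop :=
  ∀ j : Fin n,
    IsFilterRegular (M ⧸ (Ideal.span (y '' {k | k < j}) • (⊤ : Submodule R M))) (y j)

end ArtCof

end

/-! Conditions (i), (ii) and (iii) are compared by dimension shifting. In degree zero each of them
says that `0 :_M 𝔞` has finite length. If this holds, passing from `M` to `M/Γ_𝔞(M)` does not affect
the conditions in positive degrees. The quotient has no `𝔞`-torsion, so it embeds in an injective
`E` without `𝔞`-torsion, on which all three cohomologies vanish in every degree. The cokernel of the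
embedding then carries the same conditions one degree lower. `Devissage` records these three facts,
and `Devissage.forall_lt_iff` concludes by induction on `n`.

The substance lies in removing `Γ_𝔞(M)`. Local cohomology in positive degree vanishes on `𝔞`-torsion
modules, because these embed in injective `𝔞`-torsion modules (Artin–Rees). For Ext and Koszul
cohomology one needs finite length on `T = Γ_𝔞(M)`. By Melkersson's criterion `T` is artinian, and
`0 :_T 𝔞` has finite length. Modules with these two properties (`HasFiniteSocle`) are closed under
submodules, extensions and, less obviously, quotients, which is `HasFiniteSocle.of_surjective`. The
Ext and Koszul modules of `T` therefore stay in the class; being killed by `𝔞`, they have finite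
length.

For finitely generated `M`, (iv) yields a filter-regular sequence: prime avoidance gives an element
of `𝔞` regular on `M/Γ_𝔞(M)`, and one passes to `M/yM`. Conversely, since `y ∈ 𝔞` acts as zero on
`Ext(R/𝔞, M)`, finite length moves up from `M/yM` to `M` with a shift of one degree, which gives (v)
⇒ (ii). -/

namespace ArtCof

/-! ### Artinian modules with torsion of finite length, and their quotients -/

section FiniteSocle

variable {R : Type u} [CommRing R]
variable {N M Q : Type u} [AddCommGroup N] [Module R N] [AddCommGroup M] [Module R M]
  [AddCommGroup Q] [Module R Q]

open Submodule

/-- A linear map restricts to the submodules of elements killed by `s`. -/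
def torsionBySetMap (s : Set R) (f : M →ₗ[R] N) : torsionBySet R M s →ₗ[R] torsionBySet R N s :=
  f.restrict fun m hm => by
    rw [mem_torsionBySet_iff] at hm ⊢
    intro a
    rw [← map_smul, hm, map_zero]

lemma torsionBySetMap_injective (s : Set R) {f : M →ₗ[R] N} (hf : Function.Injective f) :
    Function.Injective (torsionBySetMap s f) := fun _ _ h =>
  Subtype.ext (hf (congrArg Subtype.val h))

lemma isNoetherian_torsionBySet_of_injective {s : Set R} (f : M →ₗ[R] N)
    (hf : Function.Injective f) (h : IsNoetherian R (torsionBySet R N s)) :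
    IsNoetherian R (torsionBySet R M s) :=
  isNoetherian_of_injective _ (torsionBySetMap_injective s hf)

lemma isNoetherian_torsionBySet_of_exact {s : Set R} {f : N →ₗ[R] M} {g : M →ₗ[R] Q}
    (hf : Function.Injective f) (hfg : Function.Exact f g)
    (hN : IsNoetherian R (torsionBySet R N s)) (hQ : IsNoetherian R (torsionBySet R Q s)) :
    IsNoetherian R (torsionBySet R M s) := by
  refine isNoetherian_of_range_eq_ker (torsionBySetMap s f) (torsionBySetMap s g) ?_
  ext ⟨m, hm⟩
  constructor
  · rintro ⟨n, hn⟩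
    have hn' : f n = m := congrArg Subtype.val hn
    exact Subtype.ext (show g m = 0 by rw [← hn', hfg.apply_apply_eq_zero])
  · intro h
    obtain ⟨n, rfl⟩ := (hfg m).mp (congrArg Subtype.val h)
    refine ⟨⟨n, ?_⟩, rfl⟩
    rw [mem_torsionBySet_iff] at hm ⊢
    intro a
    apply hf
    rw [map_smul, hm, map_zero]

/-- Both modules are the same submodule of `M`; this form splits off one generator, for inductions
on a finite generating set. -/
lemma isNoetherian_torsionBySet_insert {s : Set R} {x : R} :
    IsNoetherian R (torsionBySet R M (insert x s)) ↔
      IsNoetherian R (torsionBySet R (torsionBy R M x) s) := by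
  constructor
  · intro h
    refine isNoetherian_of_injective
      (((torsionBy R M x).subtype ∘ₗ (torsionBySet R (torsionBy R M x) s).subtype).codRestrict
        (torsionBySet R M (insert x s)) ?_) ?_
    · rintro ⟨⟨m, hm⟩, hm'⟩
      rw [mem_torsionBySet_iff] at hm' ⊢
      rintro ⟨a, rfl | ha⟩
      · exact hm
      · exact congrArg Subtype.val (hm' ⟨a, ha⟩)
    · intro a b h
      exact Subtype.ext (Subtype.ext (congrArg (fun z => (z.1 : M)) h))
  · intro h
    have h1 : ∀ m : torsionBySet R M (insert x s), (m : M) ∈ torsionBy R M x := fun m =>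
      (mem_torsionBySet_iff _ _).mp m.2 ⟨x, Set.mem_insert _ _⟩
    refine isNoetherian_of_injective
      (((torsionBySet R M (insert x s)).subtype.codRestrict (torsionBy R M x) h1).codRestrict
        (torsionBySet R (torsionBy R M x) s) ?_) ?_
    · intro m
      rw [mem_torsionBySet_iff]
      rintro ⟨a, ha⟩
      exact Subtype.ext ((mem_torsionBySet_iff _ _).mp m.2 ⟨a, Set.mem_insert_of_mem _ ha⟩)
    · intro a b h
      exact Subtype.ext (congrArg (fun z => (z.1.1 : M)) h)

/-- The class of artinian modules whose `s`-torsion is noetherian, hence of finite length. -/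
def HasFiniteSocle (s : Set R) (M : Type u) [AddCommGroup M] [Module R M] : Prop :=
  IsArtinian R M ∧ IsNoetherian R (torsionBySet R M s)

lemma HasFiniteSocle.of_injective {s : Set R} (f : M →ₗ[R] N) (hf : Function.Injective f)
    (h : HasFiniteSocle s N) : HasFiniteSocle s M :=
  have := h.1
  ⟨isArtinian_of_injective f hf, isNoetherian_torsionBySet_of_injective f hf h.2⟩

lemma HasFiniteSocle.of_exact {s : Set R} {f : N →ₗ[R] M} {g : M →ₗ[R] Q}
    (hf : Function.Injective f) (hfg : Function.Exact f g)
    (hN : HasFiniteSocle s N) (hQ : HasFiniteSocle s Q) : HasFiniteSocle s M :=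
  have := hN.1
  have := hQ.1
  ⟨isArtinian_of_range_eq_ker f g (LinearMap.exact_iff.mp hfg).symm,
    isNoetherian_torsionBySet_of_exact hf hfg hN.2 hQ.2⟩

/-- If the `x`-torsion of a module lies in the class, so does the `x ^ k`-torsion. -/
lemma HasFiniteSocle.torsionBy_pow {s : Set R} {x : R}
    (h : HasFiniteSocle s (torsionBy R M x)) (k : ℕ) :
    HasFiniteSocle s (torsionBy R M (x ^ k)) := by
  induction k with
  | zero =>
    refine h.of_injective 0 fun a b _ => Subtype.ext ?_
    have h0 : ∀ m : M, x ^ 0 • m = 0 → m = 0 := fun m hm => by simpa using hm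
    rw [h0 _ a.2, h0 _ b.2]
  | succ k ih =>
    -- Multiplication by `x ^ k` sends `0 : x ^ (k + 1)` into `0 : x` with kernel `0 : x ^ k`.
    let f : torsionBy R M (x ^ k) →ₗ[R] torsionBy R M (x ^ (k + 1)) :=
      Submodule.inclusion fun m (hm : x ^ k • m = 0) =>
        show x ^ (k + 1) • m = 0 by rw [pow_succ', mul_smul, hm, smul_zero]
    let g : torsionBy R M (x ^ (k + 1)) →ₗ[R] torsionBy R M x :=
      (LinearMap.lsmul R M (x ^ k)).restrict fun m (hm : x ^ (k + 1) • m = 0) =>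
        show x • x ^ k • m = 0 by rw [← mul_smul, ← pow_succ', hm]
    refine HasFiniteSocle.of_exact (f := f) (g := g) (Submodule.inclusion_injective _) ?_ ih h
    rintro ⟨m, hm⟩
    constructor
    · intro hg
      exact ⟨⟨m, congrArg Subtype.val hg⟩, rfl⟩
    · rintro ⟨n, hn⟩
      have : (n : M) = m := congrArg Subtype.val hn
      subst this
      exact Subtype.ext n.2

/-- For an artinian module, `M / x M` is a quotient of the `x ^ k`-torsion for large `k`. -/
lemma exists_eq_torsionBy_pow_add_smul (R : Type u) [CommRing R] (M : Type u) [AddCommGroup M]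
    [Module R M] [IsArtinian R M] (x : R) :
    ∃ k : ℕ, ∀ m : M, ∃ t ∈ torsionBy R M (x ^ k), ∃ m', m = t + x • m' := by
  have ev := (LinearMap.lsmul R M x).eventually_codisjoint_ker_pow_range_pow
  obtain ⟨k, hk⟩ := Filter.eventually_atTop.mp ev
  -- Fitting: `M` is the sum of the kernel and the range of a high power of `x`. The exponent is
  -- made positive so that this range lies in `x M`.
  have hk := hk (k + 1) (Nat.le_succ k)
  have hpow : ∀ (j : ℕ) (m : M), ((LinearMap.lsmul R M x) ^ j) m = x ^ j • m := fun j => by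
    induction j with
    | zero => intro m; simp
    | succ j ih => intro m; rw [pow_succ, Module.End.mul_apply, ih, pow_succ, mul_smul]; rfl
  refine ⟨k + 1, fun m => ?_⟩
  obtain ⟨t, ht, r, ⟨m', rfl⟩, hm⟩ := Submodule.mem_sup.mp (hk.eq_top ▸ mem_top : m ∈ _ ⊔ _)
  refine ⟨t, ?_, x ^ k • m', ?_⟩
  · rw [LinearMap.mem_ker, hpow] at ht
    exact ht
  · rw [← hm, hpow, pow_succ', mul_smul]

/-- The `s`-finite-socle class is closed under quotients when `s` is finite. -/
theorem HasFiniteSocle.of_surjective {s : Set R} (hs : s.Finite) (f : M →ₗ[R] Q)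
    (hf : Function.Surjective f) (h : HasFiniteSocle s M) : HasFiniteSocle s Q := by
  induction s, hs using Set.Finite.induction_on generalizing M Q with
  | empty =>
    have := h.1
    have := h.2
    -- With no generators the torsion is all of `M`, so `M` has finite length.
    have : IsNoetherian R M := isNoetherian_of_injective
      (LinearMap.id.codRestrict (torsionBySet R M ∅) fun m => by
        rw [mem_torsionBySet_iff]; rintro ⟨a, ha⟩; exact ha.elim)
      fun a b h => congrArg Subtype.val h
    have := isNoetherian_of_surjective f (LinearMap.range_eq_top.mpr hf)
    exact ⟨isArtinian_of_surjective M f hf, inferInstance⟩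
  | @insert x s _ _ ih =>
    have hM := h.1
    have hQ : IsArtinian R Q := isArtinian_of_surjective M f hf
    refine ⟨hQ, isNoetherian_torsionBySet_insert.mpr ?_⟩
    have hx : HasFiniteSocle s (torsionBy R M x) :=
      ⟨inferInstance, isNoetherian_torsionBySet_insert.mp h.2⟩
    -- The snake lemma for multiplication by `x` gives an exact sequence `0 :_M x → 0 :_Q x → K / x
    -- K`. The outer terms lie in the class for the smaller set `s`: `K / x K` because it is a
    -- quotient of `0 :_K x ^ k` for large `k`.
    let K := LinearMap.ker f
    have hK : HasFiniteSocle s (torsionBy R K x) := hx.of_injective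
      (K.subtype.restrict (p := torsionBy R K x) (q := torsionBy R M x)
        fun m (hm : x • m = 0) => show x • (m : M) = 0 from congrArg Subtype.val hm)
      fun a b h => Subtype.ext (Subtype.ext (congrArg (fun z => (z.1 : M)) h))
    let xK : Submodule R K := LinearMap.range (LinearMap.lsmul R K x)
    have hKx : HasFiniteSocle s (K ⧸ xK) := by
      obtain ⟨k, hk⟩ := exists_eq_torsionBy_pow_add_smul R K x
      refine ih (xK.mkQ ∘ₗ (torsionBy R K (x ^ k)).subtype) ?_ (hK.torsionBy_pow k)
      intro q
      obtain ⟨m, rfl⟩ := xK.mkQ_surjective q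
      obtain ⟨t, ht, m', hm⟩ := hk m
      refine ⟨⟨t, ht⟩, ?_⟩
      refine (Submodule.Quotient.eq _).mpr ⟨-m', ?_⟩
      rw [hm, map_neg]
      simp
    let g : torsionBy R M x →ₗ[R] torsionBy R Q x :=
      f.restrict fun m (hm : x • m = 0) => show x • f m = 0 by rw [← map_smul, hm, map_zero]
    -- The connecting map is handled upstairs: `q` is multiplication by `x` from `W = f⁻¹(0 :_Q x)`
    -- to `K / x K`. Thus the cokernel of `g` is a quotient of `W / ker q`, itself a submodule of `K
    -- / x K`.
    let W : Submodule R M := (torsionBy R Q x).comap f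
    let p : W →ₗ[R] torsionBy R Q x := f.restrict fun m hm => hm
    have hp : Function.Surjective p := by
      rintro ⟨q, hq⟩
      obtain ⟨m, rfl⟩ := hf q
      exact ⟨⟨m, hq⟩, rfl⟩
    let q : W →ₗ[R] K ⧸ xK := xK.mkQ ∘ₗ
      (LinearMap.lsmul R M x).restrict fun m (hm : x • f m = 0) =>
        show f (x • m) = 0 by rw [map_smul, hm]
    have hW : HasFiniteSocle s (W ⧸ LinearMap.ker q) := hKx.of_injective
      ((LinearMap.ker q).liftQ q le_rfl) (LinearMap.ker_eq_bot.mp (ker_liftQ_eq_bot' _ q rfl))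
    have hle : LinearMap.ker q ≤ (LinearMap.range g).comap p := by
      rintro ⟨m, hm⟩ hq
      obtain ⟨m', hm'⟩ := (Submodule.Quotient.mk_eq_zero _).mp hq
      have hm'' : x • (m' : M) = x • m := congrArg Subtype.val hm'
      -- If `x m = x m'` with `m' ∈ K`, then `m - m'` is killed by `x` and has the same image in `Q`
      -- as `m`.
      refine ⟨⟨m - m', ?_⟩, Subtype.ext ?_⟩
      · change x • (m - (m' : M)) = 0
        rw [smul_sub, hm'', sub_self]
      · change f (m - m') = f m
        rw [map_sub, show f m' = 0 from m'.2, sub_zero]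
    have hquot : HasFiniteSocle s (torsionBy R Q x ⧸ LinearMap.range g) :=
      by
      refine ih (mapQ _ _ p hle) (fun z => ?_) hW
      obtain ⟨z, rfl⟩ := (LinearMap.range g).mkQ_surjective z
      obtain ⟨w, rfl⟩ := hp z
      exact ⟨(LinearMap.ker q).mkQ w, rfl⟩
    have hrange : HasFiniteSocle s (LinearMap.range g) :=
      ih g.rangeRestrict g.surjective_rangeRestrict hx
    exact (HasFiniteSocle.of_exact (Submodule.subtype_injective _)
      (LinearMap.exact_subtype_mkQ _) hrange hquot).2

end FiniteSocle

/-! ### Melkersson's criterion for artinian modules -/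

section Melkersson

variable {R : Type u} [CommRing R] {V : Type u} [AddCommGroup V] [Module R V]

open Submodule

/-- Induction on the power of `x` killing `v`: if `x ^ (k + 1)` kills `v`, subtracting a suitable `w
∈ N'` leaves an element killed by `x ^ k`. Hence `N` is determined, among submodules containing a
given `N'`, by the traces of all `x ^ k N` on `0 :_V x`. -/
lemma le_of_map_pow_inf_torsionBy_le {x : R} (hx : ∀ v : V, ∃ k : ℕ, x ^ k • v = 0)
    {N N' : Submodule R V} (hN : N' ≤ N)
    (h : ∀ k : ℕ, ∀ v ∈ N, x • x ^ k • v = 0 → ∃ w ∈ N', x ^ k • w = x ^ k • v) : N ≤ N' := by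
  intro v hv
  obtain ⟨k, hk⟩ := hx v
  induction k generalizing v with
  | zero =>
    rw [pow_zero, one_smul] at hk
    rw [hk]
    exact zero_mem _
  | succ k ih =>
    obtain ⟨w, hw, hwv⟩ := h k v hv (by rw [← mul_smul, ← pow_succ', hk])
    have := ih (sub_mem hv (hN hw)) (by rw [smul_sub, hwv, sub_self])
    simpa using add_mem this hw

/-- A module all of whose elements are killed by powers of `x`, and whose `x`-torsion is artinian,
is artinian. -/
theorem isArtinian_of_torsionBy {x : R} (hx : ∀ v : V, ∃ k : ℕ, x ^ k • v = 0)
    (h : IsArtinian R (torsionBy R V x)) : IsArtinian R V := by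
  rw [← monotone_stabilizes_iff_artinian] at h ⊢
  intro f
  -- The trace of `x ^ k N` on `0 :_V x`, which shrinks as `k` grows and as `N` shrinks.
  let L : Submodule R V → ℕ → Submodule R (torsionBy R V x) := fun N k =>
    (N.map (LinearMap.lsmul R V (x ^ k))).comap (torsionBy R V x).subtype
  have L_mono : ∀ {N N' : Submodule R V} {k k' : ℕ}, N ≤ N' → k' ≤ k → L N k ≤ L N' k' := by
    rintro N N' k k' hN hk ⟨t, ht⟩ ⟨v, hv, hvt⟩
    refine ⟨x ^ (k - k') • v, smul_mem _ _ (hN hv), ?_⟩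
    change x ^ k' • x ^ (k - k') • v = t
    rw [← mul_smul, ← pow_add, Nat.add_sub_cancel' hk]
    exact hvt
  have f_anti : ∀ {i j : ℕ}, i ≤ j → (OrderDual.ofDual (f j)) ≤ OrderDual.ofDual (f i) :=
    fun hij => f.monotone hij
  obtain ⟨n₀, hn₀⟩ := h ⟨fun j => OrderDual.toDual (L (OrderDual.ofDual (f j)) j),
    fun i j hij => L_mono (f_anti hij) hij⟩
  have hk := fun k => h ⟨fun j => OrderDual.toDual (L (OrderDual.ofDual (f j)) k),
    fun i j hij => L_mono (f_anti hij) le_rfl⟩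
  choose N hN using hk
  -- The diagonal chain is stationary from `n₀` on, which controls all `k ≥ n₀` at once. Only the
  -- finitely many `k < n₀` need their own bounds `N k`.
  let n := max n₀ ((Finset.range n₀).sup N)
  have key : ∀ m, n ≤ m → ∀ k, L (OrderDual.ofDual (f n)) k ≤ L (OrderDual.ofDual (f m)) k := by
    intro m hm k
    rcases lt_or_ge k n₀ with hk | hk
    · have hNn : N k ≤ n := le_max_of_le_right (Finset.le_sup (f := N) (Finset.mem_range.mpr hk))
      have h1 : L (OrderDual.ofDual (f (N k))) k = L (OrderDual.ofDual (f n)) k := hN k n hNn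
      have h2 : L (OrderDual.ofDual (f (N k))) k = L (OrderDual.ofDual (f m)) k :=
        hN k m (hNn.trans hm)
      rw [← h1, h2]
    · have h1 : L (OrderDual.ofDual (f n₀)) n₀ = L (OrderDual.ofDual (f (max m k))) (max m k) :=
        hn₀ (max m k) (hk.trans (le_max_right _ _))
      calc L (OrderDual.ofDual (f n)) k ≤ L (OrderDual.ofDual (f n₀)) n₀ :=
            L_mono (f_anti (le_max_left _ _)) hk
        _ = _ := h1
        _ ≤ _ := L_mono (f_anti (le_max_left _ _)) (le_max_right _ _)
  refine ⟨n, fun m hm => le_antisymm (f.monotone hm) ?_⟩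
  refine le_of_map_pow_inf_torsionBy_le hx (f_anti hm) fun k v hv hkv => ?_
  obtain ⟨w, hw, hwv⟩ := key m hm k (show ⟨x ^ k • v, hkv⟩ ∈ L _ k from ⟨v, hv, rfl⟩)
  exact ⟨w, hw, hwv⟩

/-- A module all of whose elements are killed by powers of each member of the finite set `s`, and
whose `s`-torsion is artinian, is artinian. -/
theorem isArtinian_of_torsionBySet {s : Set R} (hs : s.Finite)
    (hx : ∀ x ∈ s, ∀ v : V, ∃ k : ℕ, x ^ k • v = 0)
    (h : IsArtinian R (torsionBySet R V s)) : IsArtinian R V := by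
  induction s, hs using Set.Finite.induction_on generalizing V with
  | empty =>
    exact isArtinian_of_injective
      (LinearMap.id.codRestrict (torsionBySet R V ∅) fun m => by
        rw [mem_torsionBySet_iff]; rintro ⟨a, ha⟩; exact ha.elim)
      fun a b h => congrArg Subtype.val h
  | @insert x s _ _ ih =>
    refine isArtinian_of_torsionBy (hx x (Set.mem_insert _ _)) (ih ?_ ?_)
    · rintro y hy ⟨v, hv⟩
      obtain ⟨k, hk⟩ := hx y (Set.mem_insert_of_mem _ hy) v
      exact ⟨k, Subtype.ext hk⟩
    · refine isArtinian_of_injective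
        (((torsionBy R V x).subtype ∘ₗ (torsionBySet R (torsionBy R V x) s).subtype).codRestrict
          (torsionBySet R V (insert x s)) ?_) ?_
      · rintro ⟨⟨m, hm⟩, hm'⟩
        rw [mem_torsionBySet_iff] at hm' ⊢
        rintro ⟨a, rfl | ha⟩
        · exact hm
        · exact congrArg Subtype.val (hm' ⟨a, ha⟩)
      · intro a b h
        exact Subtype.ext (Subtype.ext (congrArg (fun z => (z.1 : V)) h))

end Melkersson

end ArtCof

namespace ArtCof

/-! ### The torsion functor `Γ_𝔞` and injective modules -/

section Gamma

variable {R : Type u} [CommRing R] (𝔞 : Ideal R)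

/-- The submodule `Γ_𝔞(M)` of elements killed by some power of `𝔞`. -/
def gamma (M : Type u) [AddCommGroup M] [Module R M] : Submodule R M where
  carrier := {m | ∃ k : ℕ, ∀ c ∈ 𝔞 ^ k, c • m = 0}
  zero_mem' := ⟨0, fun _ _ => smul_zero _⟩
  add_mem' := by
    rintro a b ⟨k, hk⟩ ⟨l, hl⟩
    refine ⟨max k l, fun c hc => ?_⟩
    rw [smul_add, hk c (Ideal.pow_le_pow_right (le_max_left _ _) hc),
      hl c (Ideal.pow_le_pow_right (le_max_right _ _) hc), add_zero]
  smul_mem' := by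
    rintro r m ⟨k, hk⟩
    exact ⟨k, fun c hc => by rw [smul_comm, hk c hc, smul_zero]⟩

variable {𝔞} {M : Type u} [AddCommGroup M] [Module R M]

lemma mem_gamma {m : M} : m ∈ gamma 𝔞 M ↔ ∃ k : ℕ, ∀ c ∈ 𝔞 ^ k, c • m = 0 := Iff.rfl

/-- A linear map from a finitely generated ideal to `Γ_𝔞(M)` is killed by a power of `𝔞`. -/
lemma exists_pow_smul_eq_zero_of_fg {J : Ideal R} (hJ : J.FG) (g : J →ₗ[R] M)
    (hg : ∀ j, g j ∈ gamma 𝔞 M) : ∃ k : ℕ, ∀ c ∈ 𝔞 ^ k, ∀ j, c • g j = 0 := by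
  have : Module.Finite R J := Module.Finite.iff_fg.mpr hJ
  obtain ⟨s, hs⟩ := Module.Finite.fg_top (R := R) (M := J)
  choose k hk using hg
  refine ⟨s.sup k, fun c hc j => ?_⟩
  have : (⊤ : Submodule R J) ≤ LinearMap.ker ((LinearMap.lsmul R M c) ∘ₗ g) := by
    rw [← hs, Submodule.span_le]
    intro j hj
    exact hk j c (Ideal.pow_le_pow_right (Finset.le_sup hj) hc)
  exact this (Submodule.mem_top (x := j))

variable (𝔞) in
/-- The module `M` has no nonzero element killed by `𝔞`. -/
def NoTorsion (M : Type u) [AddCommGroup M] [Module R M] : Prop :=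
  ∀ m : M, (∀ c ∈ 𝔞, c • m = 0) → m = 0

lemma NoTorsion.pow (h : NoTorsion 𝔞 M) (k : ℕ) : NoTorsion (𝔞 ^ k) M := by
  induction k with
  | zero => exact fun m hm => by simpa using hm 1 (by simp)
  | succ k ih =>
    refine fun m hm => ih m fun c hc => h _ fun d hd => ?_
    rw [← mul_smul]
    exact hm _ (by rw [pow_succ']; exact Ideal.mul_mem_mul hd hc)

/-- If `𝔞 m` lies in `Γ_𝔞(M)`, finite generation of `𝔞` gives one power `𝔞 ^ k` killing all of `𝔞
m`, so `𝔞 ^ (k + 1)` kills `m`. -/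
lemma noTorsion_quotient_gamma (h𝔞 : 𝔞.FG) : NoTorsion 𝔞 (M ⧸ gamma 𝔞 M) := by
  intro q hq
  obtain ⟨m, rfl⟩ := (gamma 𝔞 M).mkQ_surjective q
  obtain ⟨k, hk⟩ := exists_pow_smul_eq_zero_of_fg (M := M) (𝔞 := 𝔞) h𝔞
    ((LinearMap.toSpanSingleton R M m) ∘ₗ 𝔞.subtype) fun j =>
      (Submodule.Quotient.mk_eq_zero _).mp (hq j j.2)
  refine (Submodule.Quotient.mk_eq_zero _).mpr ⟨k + 1, ?_⟩
  suffices h : 𝔞 ^ k * 𝔞 ≤ LinearMap.ker (LinearMap.toSpanSingleton R M m) from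
    fun c hc => h (by rwa [← pow_succ])
  refine Ideal.mul_le.mpr fun c hc d hd => ?_
  change (c * d) • m = 0
  rw [mul_smul]
  exact hk c hc ⟨d, hd⟩

/-- Over a noetherian ring, `Γ_𝔞` preserves injective modules. -/
theorem injective_gamma [IsNoetherianRing R] [Module.Injective R M] :
    Module.Injective R (gamma 𝔞 M) := by
  refine Module.Baer.injective fun J g => ?_
  obtain ⟨k, hk⟩ := exists_pow_smul_eq_zero_of_fg (M := M) (𝔞 := 𝔞)
    (IsNoetherian.noetherian J) ((gamma 𝔞 M).subtype ∘ₗ g) fun j => (g j).2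
  -- Artin–Rees: `𝔞 ^ (k + l) ∩ J = 𝔞 ^ k (𝔞 ^ l ∩ J)`. As `𝔞 ^ k` kills the image of `g`, the map
  -- `g` vanishes on `J ∩ 𝔞 ^ (k + l)`.
  obtain ⟨l, hl⟩ := 𝔞.exists_pow_inf_eq_pow_smul (M := R) J
  have hl := hl (k + l) (Nat.le_add_left _ _)
  rw [Nat.add_sub_cancel] at hl
  let n := k + l
  have hg : ∀ j : J, (j : R) ∈ 𝔞 ^ n → g j = 0 := by
    intro j hj
    have h1 : (j : R) ∈ 𝔞 ^ k • (𝔞 ^ l • (⊤ : Ideal R) ⊓ J) := by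
      rw [← hl]
      exact ⟨by simpa using hj, j.2⟩
    have h2 : 𝔞 ^ k • (𝔞 ^ l • (⊤ : Ideal R) ⊓ J) ≤ (LinearMap.ker g).map J.subtype := by
      refine Submodule.smul_le.mpr fun c hc d hd => ?_
      refine ⟨c • ⟨d, hd.2⟩, ?_, rfl⟩
      have := hk c hc ⟨d, hd.2⟩
      exact Subtype.ext (by rw [map_smul]; exact this)
    obtain ⟨j', hj', hjj'⟩ := h2 h1
    rwa [← Subtype.ext hjj']
  let p : Submodule R J := Submodule.comap J.subtype (𝔞 ^ n)
  let f : (J ⧸ p) →ₗ[R] (R ⧸ (𝔞 ^ n : Ideal R)) := Submodule.mapQ _ _ J.subtype le_rfl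
  have hf : Function.Injective f := by
    rw [← LinearMap.ker_eq_bot]
    exact Submodule.ker_liftQ_eq_bot _ _ _ (by
      intro j hj
      exact (Submodule.Quotient.mk_eq_zero (𝔞 ^ n)).mp hj)
  -- Extending from `J / (J ∩ 𝔞 ^ n)` to `R / 𝔞 ^ n`, rather than to `R`, forces the image of `1` to
  -- be killed by `𝔞 ^ n`, hence to lie in `Γ_𝔞(M)`.
  obtain ⟨e, he⟩ := Module.Injective.out f hf
    (p.liftQ ((gamma 𝔞 M).subtype ∘ₗ g) fun j hj => by
      rw [LinearMap.mem_ker, LinearMap.comp_apply, hg j hj, map_zero])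
  let z : M := e (Submodule.Quotient.mk 1)
  have hz : ∀ r : R, r • z = e (Submodule.Quotient.mk r) := fun r => by
    rw [← map_smul, ← Submodule.Quotient.mk_smul, smul_eq_mul, mul_one]
  have hzmem : z ∈ gamma 𝔞 M :=
    ⟨n, fun c hc => by rw [hz, (Submodule.Quotient.mk_eq_zero _).mpr hc, map_zero]⟩
  refine ⟨LinearMap.toSpanSingleton R _ ⟨z, hzmem⟩, fun r hr => Subtype.ext ?_⟩
  exact (hz r).trans (he (Submodule.Quotient.mk ⟨r, hr⟩))

/-- Over a noetherian ring, `I / Γ_𝔞(I)` is injective for `I` injective. -/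
theorem injective_quotient_gamma [IsNoetherianRing R] [Module.Injective R M] :
    Module.Injective R (M ⧸ gamma 𝔞 M) := by
  have hΓ : Module.Injective R (gamma 𝔞 M) := injective_gamma
  -- `Γ_𝔞(M)` is injective, hence a direct summand, and the quotient is a retract of the injective
  -- module `M`.
  obtain ⟨r, hr⟩ := hΓ.out (gamma 𝔞 M).subtype (Submodule.subtype_injective _) LinearMap.id
  let s : (M ⧸ gamma 𝔞 M) →ₗ[R] M :=
    (gamma 𝔞 M).liftQ (LinearMap.id - (gamma 𝔞 M).subtype ∘ₗ r) fun m hm => by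
      have := hr ⟨m, hm⟩
      simp only [Submodule.subtype_apply, LinearMap.id_apply] at this
      simp [this]
  have hs : ∀ q, (gamma 𝔞 M).mkQ (s q) = q := fun q => by
    obtain ⟨m, rfl⟩ := (gamma 𝔞 M).mkQ_surjective q
    refine (Submodule.Quotient.eq _).mpr ?_
    simp [s]
  refine ⟨fun X Y _ _ _ _ f hf g => ?_⟩
  obtain ⟨h, hh⟩ := Module.Injective.out f hf (s ∘ₗ g)
  exact ⟨(gamma 𝔞 M).mkQ ∘ₗ h, fun x => by
    rw [LinearMap.comp_apply, hh, LinearMap.comp_apply, hs]⟩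

lemma exists_injective_embedding (R : Type u) [CommRing R] (M : Type u) [AddCommGroup M]
    [Module R M] : ∃ (E : ModuleCat.{u} R) (f : M →ₗ[R] E), Function.Injective f ∧
      Module.Injective R E := by
  let P := (EnoughInjectives.presentation (ModuleCat.of R M)).some
  refine ⟨P.J, P.f.hom, (ModuleCat.mono_iff_injective _).mp P.mono, ?_⟩
  have := P.injective
  exact Module.injective_module_of_injective_object R P.J

/-- A module without `𝔞`-torsion embeds into an injective module without `𝔞`-torsion. -/
theorem exists_injective_noTorsion_embedding [IsNoetherianRing R] (hM : NoTorsion 𝔞 M) :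
    ∃ (E : ModuleCat.{u} R) (f : M →ₗ[R] E), Function.Injective f ∧
      Module.Injective R E ∧ NoTorsion 𝔞 E := by
  obtain ⟨E, f, hf, hE⟩ := exists_injective_embedding R M
  refine ⟨ModuleCat.of R (E ⧸ gamma 𝔞 E), (gamma 𝔞 E).mkQ ∘ₗ f, ?_, injective_quotient_gamma,
    noTorsion_quotient_gamma (IsNoetherian.noetherian 𝔞)⟩
  -- An element of `M` landing in `Γ_𝔞(E)` is killed by a power of `𝔞`, hence is zero.
  refine (injective_iff_map_eq_zero _).mpr fun m hm => ?_
  obtain ⟨k, hk⟩ := (Submodule.Quotient.mk_eq_zero _).mp hm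
  exact hM.pow k m fun c hc => hf (by rw [map_smul, hk c hc, map_zero])

/-- An `𝔞`-torsion module embeds into an injective `𝔞`-torsion module. -/
theorem exists_injective_torsion_embedding [IsNoetherianRing R] (hM : gamma 𝔞 M = ⊤) :
    ∃ (E : ModuleCat.{u} R) (f : M →ₗ[R] E), Function.Injective f ∧
      Module.Injective R E ∧ gamma 𝔞 E = ⊤ := by
  obtain ⟨E, f, hf, hE⟩ := exists_injective_embedding R M
  refine ⟨ModuleCat.of R (gamma 𝔞 E), f.codRestrict (gamma 𝔞 E) fun m => ?_, ?_,
    injective_gamma, ?_⟩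
  · obtain ⟨k, hk⟩ := mem_gamma.mp (hM ▸ Submodule.mem_top : m ∈ gamma 𝔞 M)
    exact ⟨k, fun c hc => by rw [← map_smul, hk c hc, map_zero]⟩
  · exact fun a b h => hf (congrArg Subtype.val h)
  · refine Submodule.eq_top_iff'.mpr ?_
    rintro ⟨e, k, hk⟩
    exact ⟨k, fun c hc => Subtype.ext (hk c hc)⟩

lemma gamma_eq_top_of_surjective {N : Type u} [AddCommGroup N] [Module R N] (f : M →ₗ[R] N)
    (hf : Function.Surjective f) (hM : gamma 𝔞 M = ⊤) : gamma 𝔞 N = ⊤ := by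
  refine Submodule.eq_top_iff'.mpr fun n => ?_
  obtain ⟨m, rfl⟩ := hf n
  obtain ⟨k, hk⟩ := mem_gamma.mp (hM ▸ Submodule.mem_top : m ∈ gamma 𝔞 M)
  exact ⟨k, fun c hc => by rw [← map_smul, hk c hc, map_zero]⟩

lemma gamma_gamma : gamma 𝔞 (gamma 𝔞 M) = ⊤ := by
  refine Submodule.eq_top_iff'.mpr ?_
  rintro ⟨e, k, hk⟩
  exact ⟨k, fun c hc => Subtype.ext (hk c hc)⟩

/-- A short complex of modules from an injection, a surjection, and exactness in the middle. -/
lemma shortExact_of_linearMap {A B C : Type u} [AddCommGroup A] [Module R A] [AddCommGroup B]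
    [Module R B] [AddCommGroup C] [Module R C] {f : A →ₗ[R] B} {g : B →ₗ[R] C}
    (hf : Function.Injective f) (hfg : Function.Exact f g) (hg : Function.Surjective g) :
    (ShortComplex.mk (ModuleCat.ofHom f) (ModuleCat.ofHom g)
      (by rw [← ModuleCat.ofHom_comp, hfg.linearMap_comp_eq_zero]; rfl)).ShortExact where
  exact := (ShortComplex.ShortExact.moduleCat_exact_iff_function_exact _).mpr hfg
  mono_f := (ModuleCat.mono_iff_injective _).mpr hf
  epi_g := (ModuleCat.epi_iff_surjective _).mpr hg

end Gamma

end ArtCof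

namespace ArtCof

/-! ### Finite length and exact sequences -/

section FiniteLength

variable {R : Type u} [CommRing R]

open Submodule

lemma torsionBySet_eq_of_span_eq {s : Set R} {𝔞 : Ideal R} (h : Ideal.span s = 𝔞)
    (M : Type u) [AddCommGroup M] [Module R M] :
    torsionBySet R M s = torsionBySet R M (𝔞 : Set R) := by
  rw [← h]
  exact torsionBySet_eq_torsionBySet_span s

lemma HasFiniteSocle.of_surjective_of_fg {𝔞 : Ideal R} (h𝔞 : 𝔞.FG) {M Q : Type u}
    [AddCommGroup M] [Module R M] [AddCommGroup Q] [Module R Q] (f : M →ₗ[R] Q)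
    (hf : Function.Surjective f) (h : HasFiniteSocle (𝔞 : Set R) M) :
    HasFiniteSocle (𝔞 : Set R) Q := by
  obtain ⟨s, hs⟩ := h𝔞
  have hM : HasFiniteSocle (s : Set R) M := ⟨h.1, by
    rw [torsionBySet_eq_of_span_eq hs]; exact h.2⟩
  have hQ := hM.of_surjective s.finite_toSet f hf
  exact ⟨hQ.1, by rw [← torsionBySet_eq_of_span_eq hs]; exact hQ.2⟩

lemma HasFiniteSocle.pi {s : Set R} {M : Type u} [AddCommGroup M] [Module R M] {ι : Type*}
    [Finite ι] (h : HasFiniteSocle s M) : IsArtinian R (ι → M) ∧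
      IsNoetherian R (torsionBySet R (ι → M) s) := by
  have := h.1
  have := h.2
  refine ⟨inferInstance, ?_⟩
  refine isNoetherian_of_injective (M := torsionBySet R (ι → M) s) (P := ι → torsionBySet R M s)
    (LinearMap.pi fun i => (LinearMap.proj i : (ι → M) →ₗ[R] M).restrict
      (p := torsionBySet R (ι → M) s) (q := torsionBySet R M s) ?_) ?_
  · intro m hm
    rw [mem_torsionBySet_iff] at hm ⊢
    exact fun a => congrFun (hm a) i
  · intro a b h
    exact Subtype.ext (funext fun i => congrArg Subtype.val (congrFun h i))

/-- A module in the class that is killed by `𝔞` has finite length. -/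
lemma HasFiniteSocle.isFiniteLength {𝔞 : Ideal R} {M : Type u} [AddCommGroup M] [Module R M]
    (h : HasFiniteSocle (𝔞 : Set R) M) (hM : ∀ c ∈ 𝔞, ∀ m : M, c • m = 0) :
    IsFiniteLength R M := by
  have := h.1
  have := h.2
  have : IsNoetherian R M := isNoetherian_of_injective
    (LinearMap.id.codRestrict (torsionBySet R M (𝔞 : Set R)) fun m => by
      rw [mem_torsionBySet_iff]; exact fun c => hM c c.2 m) fun a b h => congrArg Subtype.val h
  exact isFiniteLength_iff_isNoetherian_isArtinian.mpr ⟨inferInstance, inferInstance⟩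

/-- If `0 :_M 𝔞` has finite length then `Γ_𝔞(M)` is artinian with socle of finite length. -/
theorem hasFiniteSocle_gamma {𝔞 : Ideal R} (h𝔞 : 𝔞.FG) {M : Type u} [AddCommGroup M] [Module R M]
    (h : IsFiniteLength R (torsionBySet R M (𝔞 : Set R))) :
    HasFiniteSocle (𝔞 : Set R) (gamma 𝔞 M) := by
  obtain ⟨h1, h2⟩ := isFiniteLength_iff_isNoetherian_isArtinian.mp h
  refine ⟨?_, isNoetherian_torsionBySet_of_injective _ (gamma 𝔞 M).subtype_injective h1⟩
  obtain ⟨s, hs⟩ := h𝔞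
  refine isArtinian_of_torsionBySet s.finite_toSet ?_ ?_
  · rintro x hx ⟨v, k, hk⟩
    have hx' : x ∈ 𝔞 := hs ▸ Ideal.subset_span hx
    exact ⟨k, Subtype.ext (hk _ (Ideal.pow_mem_pow hx' k))⟩
  · rw [torsionBySet_eq_of_span_eq hs]
    exact isArtinian_of_injective _ (torsionBySetMap_injective _ (gamma 𝔞 M).subtype_injective)

variable {A B C D : Type u} [AddCommGroup A] [Module R A] [AddCommGroup B] [Module R B]
  [AddCommGroup C] [Module R C] [AddCommGroup D] [Module R D]

lemma isFiniteLength_of_exact {f : A →ₗ[R] B} {g : B →ₗ[R] C} (h : Function.Exact f g)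
    (hA : IsFiniteLength R A) (hC : IsFiniteLength R C) : IsFiniteLength R B := by
  rw [isFiniteLength_iff_isNoetherian_isArtinian] at hA hC ⊢
  obtain ⟨_, _⟩ := hA
  obtain ⟨_, _⟩ := hC
  have h' := (LinearMap.exact_iff.mp h).symm
  exact ⟨isNoetherian_of_range_eq_ker f g h', isArtinian_of_range_eq_ker f g h'⟩

lemma isFiniteLength_iff_of_exact {f : A →ₗ[R] B} {g : B →ₗ[R] C} {h : C →ₗ[R] D}
    (hfg : Function.Exact f g) (hgh : Function.Exact g h)
    (hA : IsFiniteLength R A) (hD : IsFiniteLength R D) :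
    IsFiniteLength R B ↔ IsFiniteLength R C :=
  ⟨fun hB => isFiniteLength_of_exact hgh hB hD, fun hC => isFiniteLength_of_exact hfg hA hC⟩

/-- A linear equivalence from a four-term exact sequence with vanishing ends. -/
noncomputable def linearEquivOfExact {f : A →ₗ[R] B} {g : B →ₗ[R] C} {h : C →ₗ[R] D}
    (hfg : Function.Exact f g) (hgh : Function.Exact g h) (hA : Subsingleton A)
    (hD : Subsingleton D) : B ≃ₗ[R] C :=
  LinearEquiv.ofBijective g
    ⟨(injective_iff_map_eq_zero g).mpr fun b hb => by
      obtain ⟨a, rfl⟩ := (hfg b).mp hb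
      rw [Subsingleton.elim a 0, map_zero],
    fun c => (hgh c).mp (Subsingleton.elim _ _)⟩

end FiniteLength

/-! ### Reduction to degree zero -/

section Devissage

variable {R : Type u} [CommRing R]

/-- The properties of a family of conditions on modules, indexed by the cohomological degree, that
allow one to reduce it to the condition in degree zero. -/
structure Devissage (𝔞 : Ideal R) (good : ℕ → ModuleCat.{u} R → Prop) : Prop where
  zero : ∀ M : ModuleCat.{u} R,
    good 0 M ↔ IsFiniteLength R (Submodule.torsionBySet R M (𝔞 : Set R))
  shift : ∀ S : ShortComplex (ModuleCat.{u} R), S.ShortExact → Injective S.X₂ →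
    NoTorsion 𝔞 S.X₂ → ∀ i, good (i + 1) S.X₁ ↔ good i S.X₃
  quot : ∀ M : ModuleCat.{u} R, IsFiniteLength R (Submodule.torsionBySet R M (𝔞 : Set R)) →
    ∀ i, good (i + 1) M ↔ good (i + 1) (ModuleCat.of R (M ⧸ gamma 𝔞 M))

/-- Two families of conditions admitting the same reductions agree. -/
theorem Devissage.forall_lt_iff [IsNoetherianRing R] {𝔞 : Ideal R}
    {good good' : ℕ → ModuleCat.{u} R → Prop} (h : Devissage 𝔞 good) (h' : Devissage 𝔞 good')
    (n : ℕ) (M : ModuleCat.{u} R) : (∀ i < n, good i M) ↔ (∀ i < n, good' i M) := by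
  induction n generalizing M with
  | zero => simp
  | succ n ih =>
    -- The cokernel of `M / Γ_𝔞(M) → E` depends only on `M`, not on the family of conditions, so the
    -- induction hypothesis compares both families on the same module.
    obtain ⟨E, f, hf, hE, hE'⟩ := exists_injective_noTorsion_embedding
      (noTorsion_quotient_gamma (M := M) (IsNoetherian.noetherian 𝔞))
    have hS := shortExact_of_linearMap hf (LinearMap.exact_map_mkQ_range f)
      (Submodule.mkQ_surjective _)
    have hE : Injective E := Module.injective_object_of_injective_module R E
    have key : ∀ {P : ℕ → ModuleCat.{u} R → Prop}, Devissage 𝔞 P →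
        ((∀ i < n + 1, P i M) ↔ IsFiniteLength R (Submodule.torsionBySet R M (𝔞 : Set R)) ∧
          ∀ i < n, P i (ModuleCat.of R (E ⧸ LinearMap.range f))) := by
      intro P hP
      rw [Nat.forall_lt_succ_left, hP.zero]
      refine and_congr_right fun hM => forall₂_congr fun i _ => ?_
      rw [hP.quot M hM i]
      exact hP.shift _ hS hE hE' i
    rw [key h, key h', ih]

end Devissage

/-! ### Finite length of `Extⁱ(R/𝔞, -)` -/

section Ext

variable {R : Type u} [CommRing R]

open Abelian

section Exact

variable (X : ModuleCat.{u} R) {S : ShortComplex (ModuleCat.{u} R)}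

lemma ext_exact₂ (hS : S.ShortExact) (i : ℕ) :
    Function.Exact ((Ext.mk₀ S.f).postcompOfLinear R X (add_zero i))
    ((Ext.mk₀ S.g).postcompOfLinear R X (add_zero i)) := by
  refine fun y => ⟨fun hy => Ext.covariant_sequence_exact₂ X hS y hy, ?_⟩
  rintro ⟨z, rfl⟩
  simp

lemma ext_exact₃ (hS : S.ShortExact) (i : ℕ) :
    Function.Exact ((Ext.mk₀ S.g).postcompOfLinear R X (add_zero i))
    (hS.extClass.postcompOfLinear R X (rfl : i + 1 = i + 1)) := by
  refine fun y => ⟨fun hy => Ext.covariant_sequence_exact₃ X hS y rfl hy, ?_⟩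
  rintro ⟨z, rfl⟩
  simp

lemma ext_exact₁ (hS : S.ShortExact) (i : ℕ) :
    Function.Exact (hS.extClass.postcompOfLinear R X (rfl : i + 1 = i + 1))
    ((Ext.mk₀ S.f).postcompOfLinear R X (add_zero (i + 1))) := by
  refine fun y => ⟨fun hy => Ext.covariant_sequence_exact₁ X hS y hy rfl, ?_⟩
  rintro ⟨z, rfl⟩
  simp

end Exact

/-- The class of artinian modules with socle of finite length is stable under `Extⁱ(X, -)` for
finitely generated `X`. -/
theorem HasFiniteSocle.ext [IsNoetherianRing R] {𝔞 : Ideal R} (X T : ModuleCat.{u} R)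
    [Module.Finite R X] (hT : HasFiniteSocle (𝔞 : Set R) T) (i : ℕ) :
    HasFiniteSocle (𝔞 : Set R) (Ext X T i) := by
  induction i generalizing X with
  | zero =>
    obtain ⟨k, p, hp⟩ := Module.Finite.exists_fin' R X
    have e := (Ext.linearEquiv₀ (R := R) (X := X) (Y := T)).trans ModuleCat.homLinearEquiv
    let f : Ext X T 0 →ₗ[R] (Fin k → T) := (LinearMap.pi fun i =>
      LinearMap.applyₗ (Pi.single i 1)) ∘ₗ LinearMap.lcomp R T p ∘ₗ e.toLinearMap
    refine HasFiniteSocle.of_injective (N := Fin k → T) f ?_ hT.pi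
    refine fun a b hab => e.injective ((LinearMap.cancel_right hp).mp ?_)
    exact LinearMap.pi_ext' fun i => LinearMap.ext_ring (congrFun hab i)
  | succ n ih =>
    -- Dimension shifting in the first variable: for `P → X` onto with kernel `Z`, `Ext^{n+1}(X, T)`
    -- is a quotient of `Extⁿ(Z, T)`. Here closure of the class under quotients is indispensable.
    obtain ⟨P, _, _, _, _, f, hf⟩ := Module.exists_finite_presentation R X
    let S := f.shortComplexKer
    have hS : S.ShortExact := LinearMap.shortExact_shortComplexKer hf
    exact (ih _).of_surjective_of_fg (IsNoetherian.noetherian 𝔞)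
      (hS.extClass.precompOfLinear R T (add_comm 1 n))
      (precomp_extClass_surjective_of_projective_X₂ T hS n)

lemma ext_smul_eq_zero {𝔞 : Ideal R} (M : ModuleCat.{u} R) (i : ℕ) {c : R} (hc : c ∈ 𝔞)
    (e : Ext (ModuleCat.of R (R ⧸ 𝔞)) M i) : c • e = 0 := by
  have h : c • 𝟙 (ModuleCat.of R (R ⧸ 𝔞)) = 0 := by
    ext
    change Ideal.Quotient.mk 𝔞 (c * 1) = 0
    rw [mul_one]
    exact Ideal.Quotient.eq_zero_iff_mem.mpr hc
  have : c • e = (Ext.mk₀ (c • 𝟙 (ModuleCat.of R (R ⧸ 𝔞)))).comp e (zero_add i) := by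
    simp [Ext.mk₀_smul]
  rw [this, h, Ext.mk₀_zero, Ext.zero_comp]

/-- For `T` artinian with `0 :_T 𝔞` of finite length, every `Extⁱ(R/𝔞, T)` has finite length. -/
theorem HasFiniteSocle.isFiniteLength_extQuot [IsNoetherianRing R] {𝔞 : Ideal R} {T : Type u}
    [AddCommGroup T] [Module R T] (hT : HasFiniteSocle (𝔞 : Set R) T) (i : ℕ) :
    IsFiniteLength R (ExtQuot 𝔞 T i) :=
  (HasFiniteSocle.ext (ModuleCat.of R (R ⧸ 𝔞)) (ModuleCat.of R T) hT i).isFiniteLength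
    fun _ hc => ext_smul_eq_zero _ i hc

/-- `Hom(R/𝔞, M)` is the submodule `0 :_M 𝔞`. -/
noncomputable def homQuotEquiv (𝔞 : Ideal R) (M : Type u) [AddCommGroup M] [Module R M] :
    ((R ⧸ 𝔞) →ₗ[R] M) ≃ₗ[R] Submodule.torsionBySet R M (𝔞 : Set R) :=
  LinearEquiv.ofBijective
    ((LinearMap.applyₗ (Ideal.Quotient.mk 𝔞 1)).codRestrict _ fun f => by
      rw [Submodule.mem_torsionBySet_iff]
      rintro ⟨c, hc⟩
      have : c • (Ideal.Quotient.mk 𝔞 1) = 0 := by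
        change Ideal.Quotient.mk 𝔞 (c * 1) = 0
        rw [mul_one]
        exact Ideal.Quotient.eq_zero_iff_mem.mpr hc
      rw [LinearMap.applyₗ_apply_apply, ← map_smul, this, map_zero])
    ⟨fun f g h => by
      ext
      exact congrArg Subtype.val h,
    fun m => ⟨Submodule.liftQ 𝔞 (LinearMap.toSpanSingleton R M m) fun c hc =>
      (Submodule.mem_torsionBySet_iff _ _).mp m.2 ⟨c, hc⟩, Subtype.ext (one_smul R (m : M))⟩⟩

/-- `Ext⁰(R/𝔞, M)` is the submodule `0 :_M 𝔞`. -/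
noncomputable def extQuotZeroEquiv (𝔞 : Ideal R) (M : ModuleCat.{u} R) :
    Ext (ModuleCat.of R (R ⧸ 𝔞)) M 0 ≃ₗ[R] Submodule.torsionBySet R M (𝔞 : Set R) :=
  (Ext.linearEquiv₀.trans ModuleCat.homLinearEquiv).trans (homQuotEquiv 𝔞 M)

lemma subsingleton_ext_of_injective_of_noTorsion {𝔞 : Ideal R} (E : ModuleCat.{u} R)
    [Injective E] (hE : NoTorsion 𝔞 E) (i : ℕ) :
    Subsingleton (Ext (ModuleCat.of R (R ⧸ 𝔞)) E i) := by
  cases i with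
  | zero =>
    refine (extQuotZeroEquiv 𝔞 E).toEquiv.subsingleton_congr.mpr ⟨?_⟩
    have : ∀ m : Submodule.torsionBySet R E (𝔞 : Set R), m = 0 := fun m =>
      Subtype.ext (hE m fun c hc => (Submodule.mem_torsionBySet_iff _ _).mp m.2 ⟨c, hc⟩)
    intro a b
    rw [this a, this b]
  | succ i => exact Ext.subsingleton_of_injective _ _ i

lemma shortExact_gamma (𝔞 : Ideal R) (M : Type u) [AddCommGroup M] [Module R M] :
    (ShortComplex.mk (ModuleCat.ofHom (gamma 𝔞 M).subtype) (ModuleCat.ofHom (gamma 𝔞 M).mkQ)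
      (by rw [← ModuleCat.ofHom_comp,
        (LinearMap.exact_subtype_mkQ (gamma 𝔞 M)).linearMap_comp_eq_zero]; rfl)).ShortExact :=
  shortExact_of_linearMap (gamma 𝔞 M).subtype_injective (LinearMap.exact_subtype_mkQ _)
    (gamma 𝔞 M).mkQ_surjective

/-- The modules `Extⁱ(R/𝔞, M)` having finite length is subject to dévissage. -/
theorem devissage_ext [IsNoetherianRing R] (𝔞 : Ideal R) :
    Devissage 𝔞 fun i M => IsFiniteLength R (Ext (ModuleCat.of R (R ⧸ 𝔞)) M i) where
  zero M := ⟨fun h => (extQuotZeroEquiv 𝔞 M).isFiniteLength h,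
    fun h => (extQuotZeroEquiv 𝔞 M).symm.isFiniteLength h⟩
  shift S hS hE hE' i := by
    have e := linearEquivOfExact (ext_exact₃ (ModuleCat.of R (R ⧸ 𝔞)) hS i)
      (ext_exact₁ (ModuleCat.of R (R ⧸ 𝔞)) hS i)
      (subsingleton_ext_of_injective_of_noTorsion _ hE' i)
      (subsingleton_ext_of_injective_of_noTorsion _ hE' (i + 1))
    exact ⟨fun h => e.symm.isFiniteLength h, fun h => e.isFiniteLength h⟩
  quot M hM i := by
    have hΓ := hasFiniteSocle_gamma (IsNoetherian.noetherian 𝔞) hM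
    exact isFiniteLength_iff_of_exact
      (ext_exact₂ (ModuleCat.of R (R ⧸ 𝔞)) (shortExact_gamma 𝔞 M) (i + 1))
      (ext_exact₃ (ModuleCat.of R (R ⧸ 𝔞)) (shortExact_gamma 𝔞 M) (i + 1))
      (hΓ.isFiniteLength_extQuot (i + 1)) (hΓ.isFiniteLength_extQuot (i + 1 + 1))

end Ext

end ArtCof

noncomputable section

namespace ArtCof

/-! ### Cycles and homology of complexes of modules -/

section ModuleHomology

variable {R : Type u} [CommRing R] {ι : Type*} {c : ComplexShape ι}
  (K : HomologicalComplex (ModuleCat.{u} R) c)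

lemma exists_iCycles_eq {i j : ι} (hj : c.next i = j) (x : K.X i) (hx : K.d i j x = 0) :
    ∃ z : K.cycles i, K.iCycles i z = x :=
  ⟨K.cyclesMk x j hj hx, K.i_cyclesMk x j hj hx⟩

lemma d_iCycles_apply (i j : ι) (z : K.cycles i) : K.d i j (K.iCycles i z) = 0 := by
  rw [← ModuleCat.comp_apply, K.iCycles_d]
  rfl

lemma iCycles_injective (i : ι) : Function.Injective (K.iCycles i) :=
  (ModuleCat.mono_iff_injective _).mp inferInstance

lemma homologyπ_surjective (i : ι) : Function.Surjective (K.homologyπ i) :=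
  (ModuleCat.epi_iff_surjective _).mp inferInstance

lemma exists_d_eq_of_homologyπ_eq_zero {i j : ι} (hi : c.prev j = i) (z : K.cycles j)
    (h : K.homologyπ j z = 0) : ∃ y : K.X i, K.d i j y = K.iCycles j z := by
  have hex := ShortComplex.exact_of_g_is_cokernel (ShortComplex.mk _ _
    (K.toCycles_comp_homologyπ i j)) (K.homologyIsCokernel i j hi)
  obtain ⟨y, hy⟩ := (ShortComplex.moduleCat_exact_iff _).mp hex z h
  refine ⟨y, ?_⟩
  rw [← hy]
  change _ = K.iCycles j (K.toCycles i j y)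
  rw [← ModuleCat.comp_apply, K.toCycles_i]

lemma homologyπ_eq_zero_of_d {i j : ι} (z : K.cycles j) (y : K.X i)
    (h : K.d i j y = K.iCycles j z) : K.homologyπ j z = 0 := by
  have : z = K.toCycles i j y := iCycles_injective K j (by
    rw [← ModuleCat.comp_apply, K.toCycles_i, h])
  rw [this, ← ModuleCat.comp_apply, K.toCycles_comp_homologyπ]
  rfl

end ModuleHomology

/-! ### Comparison of the two constructions of Ext -/

section ExtComparison

open Abelian Opposite

variable {R : Type u} [CommRing R]

/-- The map of cochain complexes `Hom(L, M) → Hom(K, M)` induced by a chain map `K → L`. -/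
def linearYonedaMap {K L : ChainComplex (ModuleCat.{u} R) ℕ} (φ : K ⟶ L) (M : ModuleCat.{u} R) :
    L.linearYonedaObj R M ⟶ K.linearYonedaObj R M :=
  (HomologicalComplex.unopFunctor _ _).map
    ((((linearYoneda R (ModuleCat.{u} R)).obj M).rightOp.mapHomologicalComplex _).map φ).op

lemma comp_comp_eq_of_squares {C : Type*} [Category* C] {X₁ X₂ X₃ Y₁ Y₂ Y₃ : C} {a : X₁ ⟶ Y₁}
    {b' : Y₁ ⟶ Y₂} {c' : Y₂ ⟶ Y₃} {b : X₁ ⟶ X₂} {m : X₂ ⟶ Y₂} {c : X₂ ⟶ X₃} {d : X₃ ⟶ Y₃}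
    (h₁ : a ≫ b' = b ≫ m) (h₂ : m ≫ c' = c ≫ d) : a ≫ b' ≫ c' = (b ≫ c) ≫ d := by
  rw [← Category.assoc, h₁, Category.assoc, h₂, Category.assoc]

lemma inv_comp_eq_comp_inv {C : Type*} [Category* C] {X₁ X₂ Y₁ Y₂ : C} {u : X₁ ⟶ Y₁}
    {v : Y₁ ≅ Y₂} {w : X₁ ≅ X₂} {t : X₂ ⟶ Y₂} (h : u ≫ v.hom = w.hom ≫ t) :
    w.inv ≫ u = t ≫ v.inv := by
  rw [Iso.inv_comp_eq, ← Category.assoc, Iso.eq_comp_inv, h]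

/-- `localCohomology` is built from `_root_.Ext`, a derived functor, while the long exact sequences
concern `Abelian.Ext`. The comparison must be natural in the first variable to respect the
transition maps along `R/𝔞^t → R/𝔞^s`. -/
lemma isoExt_naturality {X X' : ModuleCat.{u} R} {P : ProjectiveResolution X}
    {P' : ProjectiveResolution X'} {g : X' ⟶ X} (φ : ProjectiveResolution.Hom P' P g)
    (M : ModuleCat.{u} R) (n : ℕ) :
    ((_root_.Ext R (ModuleCat.{u} R) n).map g.op).app M ≫ (P'.isoExt n M).hom =
      (P.isoExt n M).hom ≫ HomologicalComplex.homologyMap (linearYonedaMap φ.hom M) n := by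
  have h1 := congrArg Quiver.Hom.unop (P'.isoLeftDerivedObj_inv_naturality g P φ.hom
    (by simpa using φ.hom_f_zero_comp_π_f_zero)
    ((linearYoneda R (ModuleCat.{u} R)).obj M).rightOp n)
  have h2 := HomologicalComplex.homologyOp_hom_naturality (linearYonedaMap φ.hom M) n
  exact comp_comp_eq_of_squares h1 (congrArg Quiver.Hom.unop (inv_comp_eq_comp_inv h2))

variable {X : ModuleCat.{u} R} (P : ProjectiveResolution X) (M : ModuleCat.{u} R) (n : ℕ)

lemma extMk_smul (r : R) (f : P.complex.X n ⟶ M) (m : ℕ) (hm : n + 1 = m)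
    (hf : P.complex.d m n ≫ f = 0) :
    P.extMk (r • f) m hm (by rw [Linear.comp_smul, hf, smul_zero]) = r • P.extMk f m hm hf := by
  rw [Ext.smul_eq_comp_mk₀, P.extMk_comp_mk₀]
  simp

/-- A coboundary in degree zero factors through the term of cohomological degree `1` of the
resolution, which is zero. -/
lemma extMk_zero_eq_zero_iff (f : P.complex.X 0 ⟶ M) (m : ℕ) (hm : 0 + 1 = m)
    (hf : P.complex.d m 0 ≫ f = 0) (h : P.extMk f m hm hf = 0) : f = 0 := by
  rw [← P.extEquivCohomologyClass.apply_eq_iff_eq,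
    P.extEquivCohomologyClass_extMk, P.extEquivCohomologyClass_zero,
    CochainComplex.HomComplex.CohomologyClass.mk_eq_zero_iff,
    CochainComplex.HomComplex.Cocycle.toSingleMk_mem_coboundaries_iff _ _ _ _ _ 1 (by lia)] at h
  obtain ⟨g, hg⟩ := h
  have hz : P.cochainComplex.d (-(0 : ℕ)) 1 = 0 :=
    (P.cochainComplex.isZero_of_isStrictlyLE 0 1 (by lia)).eq_of_tgt _ _
  rw [hz, Limits.zero_comp] at hg
  exact (cancel_epi (P.cochainComplexXIso (-(0 : ℕ)) 0 rfl).hom).mp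
    (hg.symm.trans Limits.comp_zero.symm)

/-- The cochain `P_n → M` underlying a cocycle. -/
def cocycleHom : (P.complex.linearYonedaObj R M).cycles n →ₗ[R] (P.complex.X n ⟶ M) :=
  ((P.complex.linearYonedaObj R M).iCycles n).hom

lemma d_cocycleHom (z : (P.complex.linearYonedaObj R M).cycles n) :
    P.complex.d (n + 1) n ≫ cocycleHom P M n z = 0 :=
  d_iCycles_apply (P.complex.linearYonedaObj R M) n (n + 1) z

lemma exists_cocycleHom_eq (f : P.complex.X n ⟶ M) (hf : P.complex.d (n + 1) n ≫ f = 0) :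
    ∃ z, cocycleHom P M n z = f :=
  exists_iCycles_eq (P.complex.linearYonedaObj R M) (j := n + 1) (by simp) f hf

/-- Sending a cocycle `P_n → M` to its class in `Extⁿ(X, M)`. -/
def extMkCycles : (P.complex.linearYonedaObj R M).cycles n →ₗ[R] Ext X M n where
  toFun z := P.extMk (cocycleHom P M n z) (n + 1) rfl (d_cocycleHom P M n z)
  map_add' z w := by
    rw [P.add_extMk]
    congr 1
    exact map_add _ _ _
  map_smul' r z := by
    rw [RingHom.id_apply, ← extMk_smul]
    congr 1
    exact map_smul _ r z

lemma extMkCycles_apply (z : (P.complex.linearYonedaObj R M).cycles n) : extMkCycles P M n z =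
    P.extMk (cocycleHom P M n z) (n + 1) rfl (d_cocycleHom P M n z) := rfl

/-- Both conditions say that the cocycle is a coboundary. Degree zero is separate because no
differential enters it. -/
lemma extMkCycles_eq_zero_iff (z : (P.complex.linearYonedaObj R M).cycles n) :
    extMkCycles P M n z = 0 ↔ (P.complex.linearYonedaObj R M).homologyπ n z = 0 := by
  rw [extMkCycles_apply]
  constructor
  · intro h
    cases n with
    | zero =>
      have h0 := extMk_zero_eq_zero_iff P M _ _ _ _ h
      have : z = 0 := iCycles_injective _ _ (h0.trans (map_zero (cocycleHom P M 0)).symm)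
      rw [this, map_zero]
    | succ p =>
      obtain ⟨g, hg⟩ := (P.extMk_eq_zero_iff _ _ _ _ p rfl).mp h
      exact homologyπ_eq_zero_of_d (P.complex.linearYonedaObj R M) (i := p) z g hg
  · intro h
    cases n with
    | zero =>
      obtain ⟨y, hy⟩ := exists_d_eq_of_homologyπ_eq_zero _ (i := 0) (by simp) z h
      have h0 : cocycleHom P M 0 z = 0 := by
        refine hy.symm.trans ?_
        rw [HomologicalComplex.shape _ _ _ (by simp)]
        rfl
      simp only [h0, P.extMk_zero]
    | succ p =>
      obtain ⟨g, hg⟩ := exists_d_eq_of_homologyπ_eq_zero _ (i := p) (by simp) z h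
      exact (P.extMk_eq_zero_iff _ _ _ _ p rfl).mpr ⟨g, hg⟩

lemma extMkCycles_surjective : Function.Surjective (extMkCycles P M n) := by
  intro e
  obtain ⟨f, hf, rfl⟩ := P.extMk_surjective e (n + 1) rfl
  obtain ⟨z, rfl⟩ := exists_cocycleHom_eq P M n f hf
  exact ⟨z, rfl⟩

/-- The comparison from the cohomology of `Hom(P, M)` to `Extⁿ(X, M)`. -/
def extOfHomology : (P.complex.linearYonedaObj R M).homology n ≃ₗ[R] Ext X M n :=
  (LinearMap.quotKerEquivOfSurjective ((P.complex.linearYonedaObj R M).homologyπ n).hom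
    (homologyπ_surjective _ n)).symm.trans
    ((Submodule.quotEquivOfEq _ _ (by
      ext z
      exact (extMkCycles_eq_zero_iff P M n z).symm)).trans
    (LinearMap.quotKerEquivOfSurjective (extMkCycles P M n) (extMkCycles_surjective P M n)))

lemma extOfHomology_homologyπ (z : (P.complex.linearYonedaObj R M).cycles n) :
    extOfHomology P M n ((P.complex.linearYonedaObj R M).homologyπ n z) = extMkCycles P M n z := by
  have h : (LinearMap.quotKerEquivOfSurjective ((P.complex.linearYonedaObj R M).homologyπ n).hom
      (homologyπ_surjective _ n)).symm ((P.complex.linearYonedaObj R M).homologyπ n z) =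
      Submodule.Quotient.mk z := by
    rw [LinearEquiv.symm_apply_eq]
    rfl
  simp only [extOfHomology, LinearEquiv.trans_apply, h]
  rfl

variable {P M} in
lemma extOfHomology_naturality {X' : ModuleCat.{u} R} {P' : ProjectiveResolution X'} {g : X' ⟶ X}
    (φ : ProjectiveResolution.Hom P' P g) (w : (P.complex.linearYonedaObj R M).homology n) :
    extOfHomology P' M n (HomologicalComplex.homologyMap (linearYonedaMap φ.hom M) n w) =
      (Ext.mk₀ g).comp (extOfHomology P M n w) (zero_add n) := by
  obtain ⟨z, rfl⟩ := homologyπ_surjective _ _ w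
  rw [extOfHomology_homologyπ, ← ModuleCat.comp_apply, HomologicalComplex.homologyπ_naturality,
    ModuleCat.comp_apply, extOfHomology_homologyπ]
  rw [extMkCycles_apply, extMkCycles_apply, ProjectiveResolution.mk₀_comp_extMk (φ := φ)]
  congr 1
  exact congrArg (fun f => f z) (HomologicalComplex.cyclesMap_i (linearYonedaMap φ.hom M) n)

/-- The `Ext` modules defined by projective resolutions agree with those defined through the
derived category. -/
def extEquiv (X M : ModuleCat.{u} R) (n : ℕ) :
    ((_root_.Ext R (ModuleCat.{u} R) n).obj (op X)).obj M ≃ₗ[R] Ext X M n :=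
  ((projectiveResolution X).isoExt n M).toLinearEquiv.trans
    (extOfHomology (projectiveResolution X) M n)

lemma extEquiv_naturality {X X' : ModuleCat.{u} R} (g : X' ⟶ X) (M : ModuleCat.{u} R) (n : ℕ)
    (w : ((_root_.Ext R (ModuleCat.{u} R) n).obj (op X)).obj M) :
    extEquiv X' M n (((_root_.Ext R (ModuleCat.{u} R) n).map g.op).app M w) =
      (Ext.mk₀ g).comp (extEquiv X M n w) (zero_add n) := by
  let φ : ProjectiveResolution.Hom (projectiveResolution X') (projectiveResolution X) g :=
    ⟨ProjectiveResolution.lift g _ _, by simpa using ProjectiveResolution.lift_commutes_zero g _ _⟩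
  have h := congrArg (fun f => f w) (isoExt_naturality φ M n)
  exact (congrArg (extOfHomology _ M n) h).trans (extOfHomology_naturality n φ _)

end ExtComparison

end ArtCof

end

noncomputable section

namespace ArtCof

/-! ### Local cohomology as a direct limit of Ext modules -/

section LocalCohomology

open Abelian Opposite

variable {R : Type u} [CommRing R] (𝔞 : Ideal R)

/-- The projection `R / 𝔞 ^ t → R / 𝔞 ^ s` for `s ≤ t`. -/
def powQuotMap {s t : ℕ} (h : s ≤ t) :
    ModuleCat.of R (R ⧸ 𝔞 ^ t) ⟶ ModuleCat.of R (R ⧸ 𝔞 ^ s) :=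
  ModuleCat.ofHom (Submodule.mapQ _ _ LinearMap.id (Ideal.pow_le_pow_right h))

lemma powQuotMap_refl (s : ℕ) : powQuotMap 𝔞 (le_refl s) = 𝟙 _ := by
  ext
  rfl

lemma powQuotMap_comp {s t v : ℕ} (h : s ≤ t) (h' : t ≤ v) :
    powQuotMap 𝔞 h' ≫ powQuotMap 𝔞 h = powQuotMap 𝔞 (h.trans h') := by
  ext
  rfl

variable (M : ModuleCat.{u} R) (i : ℕ)

/-- The transition map `Extⁱ(R/𝔞^s, M) → Extⁱ(R/𝔞^t, M)` for `s ≤ t`. -/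
def extPowMap (s t : ℕ) (h : s ≤ t) : Ext (ModuleCat.of R (R ⧸ 𝔞 ^ s)) M i →ₗ[R]
    Ext (ModuleCat.of R (R ⧸ 𝔞 ^ t)) M i :=
  (Ext.mk₀ (powQuotMap 𝔞 h)).precompOfLinear R M (zero_add i)

lemma extPowMap_apply {s t : ℕ} (h : s ≤ t) (e : Ext (ModuleCat.of R (R ⧸ 𝔞 ^ s)) M i) :
    extPowMap 𝔞 M i s t h e = (Ext.mk₀ (powQuotMap 𝔞 h)).comp e (zero_add i) := rfl

instance : DirectedSystem (fun t : ℕ => Ext (ModuleCat.of R (R ⧸ 𝔞 ^ t)) M i)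
    (fun s t h => extPowMap 𝔞 M i s t h) where
  map_self s e := by
    rw [extPowMap_apply, powQuotMap_refl, Ext.mk₀_id_comp]
  map_map s t v h h' e := by
    rw [extPowMap_apply, extPowMap_apply, extPowMap_apply, Ext.mk₀_comp_mk₀_assoc, powQuotMap_comp]

/-- Local cohomology as the direct limit of the modules `Extⁱ(R/𝔞^t, M)`. -/
abbrev LimExt : Type u :=
  Module.DirectLimit (fun t : ℕ => Ext (ModuleCat.of R (R ⧸ 𝔞 ^ t)) M i) (extPowMap 𝔞 M i)

/-- The canonical map from `Extⁱ(R/𝔞^t, M)` to the direct limit. -/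
abbrev limExtOf (t : ℕ) : Ext (ModuleCat.of R (R ⧸ 𝔞 ^ t)) M i →ₗ[R] LimExt 𝔞 M i :=
  Module.DirectLimit.of R ℕ (fun t : ℕ => Ext (ModuleCat.of R (R ⧸ 𝔞 ^ t)) M i)
    (extPowMap 𝔞 M i) t

lemma limExtOf_extPowMap {s t : ℕ} (h : s ≤ t) (e : Ext (ModuleCat.of R (R ⧸ 𝔞 ^ s)) M i) :
    limExtOf 𝔞 M i t (extPowMap 𝔞 M i s t h e) = limExtOf 𝔞 M i s e :=
  Module.DirectLimit.of_f

/-- The cocone exhibiting the direct limit as the colimit of the diagram defining local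
cohomology. -/
def limExtCocone : Limits.Cocone (localCohomology.diagram
    (localCohomology.idealPowersDiagram 𝔞) i ⋙ (evaluation _ _).obj M) where
  pt := ModuleCat.of R (LimExt 𝔞 M i)
  ι :=
    { app t := ModuleCat.ofHom (limExtOf 𝔞 M i (unop (unop t)) ∘ₗ
        (extEquiv (ModuleCat.of R (R ⧸ 𝔞 ^ (unop (unop t)))) M i).toLinearMap)
      naturality s t f := by
        ext w
        refine (congrArg (limExtOf 𝔞 M i _) (extEquiv_naturality
          (powQuotMap 𝔞 f.unop.unop.down.down) M i w)).trans ?_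
        exact limExtOf_extPowMap 𝔞 M i f.unop.unop.down.down _ }

variable {M i} in
/-- The map from the direct limit to the point of a cocone. -/
def limExtDesc (c : Limits.Cocone (localCohomology.diagram
    (localCohomology.idealPowersDiagram 𝔞) i ⋙ (evaluation _ _).obj M)) :
    LimExt 𝔞 M i →ₗ[R] c.pt :=
  Module.DirectLimit.lift R ℕ _ _
    (fun t => (c.ι.app (op (op t))).hom ∘ₗ
      (extEquiv (ModuleCat.of R (R ⧸ 𝔞 ^ t)) M i).symm.toLinearMap)
    (fun s t h e => by
      obtain ⟨w, rfl⟩ := (extEquiv (ModuleCat.of R (R ⧸ 𝔞 ^ s)) M i).surjective e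
      have h1 := extEquiv_naturality (powQuotMap 𝔞 h) M i w
      rw [extPowMap_apply, ← h1]
      refine (congrArg (c.ι.app (op (op t))) (LinearEquiv.symm_apply_apply _ _)).trans ?_
      refine Eq.trans ?_
        (congrArg (c.ι.app (op (op s))) (LinearEquiv.symm_apply_apply _ w)).symm
      exact congrArg (fun f => f w) (c.w (homOfLE h).op.op))

variable {M i} in
lemma limExtDesc_of (c : Limits.Cocone (localCohomology.diagram
    (localCohomology.idealPowersDiagram 𝔞) i ⋙ (evaluation _ _).obj M)) (t : ℕ)
    (w : ((_root_.Ext R (ModuleCat.{u} R) i).obj (op (ModuleCat.of R (R ⧸ 𝔞 ^ t)))).obj M) :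
    limExtDesc 𝔞 c (limExtOf 𝔞 M i t (extEquiv (ModuleCat.of R (R ⧸ 𝔞 ^ t)) M i w)) =
      c.ι.app (op (op t)) w := by
  refine (Module.DirectLimit.lift_of _ _ _).trans ?_
  exact congrArg (c.ι.app (op (op t))) (LinearEquiv.symm_apply_apply _ w)

/-- The direct limit is the colimit of the diagram defining local cohomology. -/
def isColimitLimExtCocone : Limits.IsColimit (limExtCocone 𝔞 M i) where
  desc c := ModuleCat.ofHom (limExtDesc 𝔞 c)
  fac c t := by
    ext w
    exact limExtDesc_of 𝔞 c (unop (unop t)) w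
  uniq c m hm := by
    refine ModuleCat.hom_ext (Module.DirectLimit.hom_ext fun t => LinearMap.ext fun e => ?_)
    obtain ⟨w, rfl⟩ := (extEquiv (ModuleCat.of R (R ⧸ 𝔞 ^ t)) M i).surjective e
    exact (congrArg (fun f => f w) (hm (op (op t)))).trans (limExtDesc_of 𝔞 c t w).symm

/-- Local cohomology is the direct limit of the modules `Extⁱ(R/𝔞^t, M)`. -/
def localCohomologyEquiv : (localCohomology 𝔞 i).obj M ≃ₗ[R] LimExt 𝔞 M i :=
  have := localCohomology.hasColimitDiagram.{u, 0} (localCohomology.idealPowersDiagram 𝔞) i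
  (Limits.colimitObjIsoColimitCompEvaluation
    (localCohomology.diagram (localCohomology.idealPowersDiagram 𝔞) i) M ≪≫
    (Limits.colimit.isColimit _).coconePointUniqueUpToIso
      (isColimitLimExtCocone 𝔞 M i)).toLinearEquiv

variable {M i}

lemma exists_limExtOf (z : LimExt 𝔞 M i) : ∃ t e, limExtOf 𝔞 M i t e = z :=
  Module.DirectLimit.exists_of z

lemma exists_extPowMap_eq_zero {t : ℕ} {e : Ext (ModuleCat.of R (R ⧸ 𝔞 ^ t)) M i}
    (h : limExtOf 𝔞 M i t e = 0) : ∃ (v : ℕ) (hv : t ≤ v), extPowMap 𝔞 M i t v hv e = 0 :=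
  Module.DirectLimit.of.zero_exact h

variable {N L : ModuleCat.{u} R} {a b c k l : ℕ}

lemma extPowMap_comp (β : Ext M N k) (h : a + k = b) {s t : ℕ} (hst : s ≤ t)
    (e : Ext (ModuleCat.of R (R ⧸ 𝔞 ^ s)) M a) :
    (extPowMap 𝔞 M a s t hst e).comp β h = extPowMap 𝔞 N b s t hst (e.comp β h) := by
  rw [extPowMap_apply, extPowMap_apply, Ext.comp_assoc _ _ _ (zero_add a) h (by lia)]

/-- The map on direct limits given by composition with a class in `Extᵏ(M, N)`. -/
def limExtPostcomp (β : Ext M N k) (h : a + k = b) : LimExt 𝔞 M a →ₗ[R] LimExt 𝔞 N b :=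
  Module.DirectLimit.lift R ℕ _ _
    (fun t => limExtOf 𝔞 N b t ∘ₗ β.postcompOfLinear R _ h) fun s t hst e => by
      change limExtOf 𝔞 N b t ((extPowMap 𝔞 M a s t hst e).comp β h) =
        limExtOf 𝔞 N b s (e.comp β h)
      rw [extPowMap_comp, limExtOf_extPowMap]

lemma limExtPostcomp_of (β : Ext M N k) (h : a + k = b) (t : ℕ)
    (e : Ext (ModuleCat.of R (R ⧸ 𝔞 ^ t)) M a) :
    limExtPostcomp 𝔞 β h (limExtOf 𝔞 M a t e) = limExtOf 𝔞 N b t (e.comp β h) :=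
  Module.DirectLimit.lift_of _ _ _

/-- Direct limits preserve exactness. -/
lemma limExtPostcomp_exact {β : Ext M N k} {γ : Ext N L l} (h : a + k = b) (h' : b + l = c)
    (hex : ∀ X : ModuleCat.{u} R,
      Function.Exact (β.postcompOfLinear R X h) (γ.postcompOfLinear R X h')) :
    Function.Exact (limExtPostcomp 𝔞 β h) (limExtPostcomp 𝔞 γ h') := by
  intro y
  constructor
  · intro hy
    obtain ⟨t, e, rfl⟩ := exists_limExtOf 𝔞 y
    rw [limExtPostcomp_of] at hy
    -- A class that dies in the limit dies at a finite stage `v`, where exactness for `R/𝔞^v`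
    -- applies.
    obtain ⟨v, hv, hev⟩ := exists_extPowMap_eq_zero 𝔞 hy
    rw [← extPowMap_comp] at hev
    obtain ⟨e', he'⟩ := (hex _ _).mp hev
    refine ⟨limExtOf 𝔞 M a v e', ?_⟩
    rw [limExtPostcomp_of, ← limExtOf_extPowMap 𝔞 N b hv]
    exact congrArg _ he'
  · rintro ⟨z, rfl⟩
    obtain ⟨t, e, rfl⟩ := exists_limExtOf 𝔞 z
    rw [limExtPostcomp_of, limExtPostcomp_of]
    exact (congrArg (limExtOf 𝔞 L c t) ((hex _).apply_apply_eq_zero e)).trans (map_zero _)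

section LongExactSequence

variable {S : ShortComplex (ModuleCat.{u} R)}

lemma limExt_exact₂ (hS : S.ShortExact) (i : ℕ) :
    Function.Exact (limExtPostcomp 𝔞 (Ext.mk₀ S.f) (add_zero i))
    (limExtPostcomp 𝔞 (Ext.mk₀ S.g) (add_zero i)) :=
  limExtPostcomp_exact 𝔞 _ _ fun X => ext_exact₂ X hS i

lemma limExt_exact₃ (hS : S.ShortExact) (i : ℕ) :
    Function.Exact (limExtPostcomp 𝔞 (Ext.mk₀ S.g) (add_zero i))
    (limExtPostcomp 𝔞 hS.extClass (rfl : i + 1 = i + 1)) :=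
  limExtPostcomp_exact 𝔞 _ _ fun X => ext_exact₃ X hS i

lemma limExt_exact₁ (hS : S.ShortExact) (i : ℕ) :
    Function.Exact (limExtPostcomp 𝔞 hS.extClass (rfl : i + 1 = i + 1))
    (limExtPostcomp 𝔞 (Ext.mk₀ S.f) (add_zero (i + 1))) :=
  limExtPostcomp_exact 𝔞 _ _ fun X => ext_exact₁ X hS i

end LongExactSequence

lemma subsingleton_limExt (h : ∀ t : ℕ, Subsingleton (Ext (ModuleCat.of R (R ⧸ 𝔞 ^ t)) M i)) :
    Subsingleton (LimExt 𝔞 M i) := by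
  refine subsingleton_of_forall_eq 0 fun z => ?_
  obtain ⟨t, e, rfl⟩ := exists_limExtOf 𝔞 z
  rw [Subsingleton.elim e 0, map_zero]

lemma extQuotZeroEquiv_apply (𝔟 : Ideal R) (e : Ext (ModuleCat.of R (R ⧸ 𝔟)) M 0) :
    (extQuotZeroEquiv 𝔟 M e : M) = Ext.homEquiv₀ e (Ideal.Quotient.mk 𝔟 1) := rfl

lemma homEquiv₀_mk₀_comp {X Y : ModuleCat.{u} R} (g : X ⟶ Y) (e : Ext Y M 0) :
    Ext.homEquiv₀ ((Ext.mk₀ g).comp e (zero_add 0)) = g ≫ Ext.homEquiv₀ e := by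
  obtain ⟨f, rfl⟩ := Ext.homEquiv₀.symm.surjective e
  rw [Equiv.apply_symm_apply, ← Equiv.eq_symm_apply]
  exact Ext.mk₀_comp_mk₀ g f

lemma homEquiv₀_comp_mk₀ {X : ModuleCat.{u} R} (g : M ⟶ N) (e : Ext X M 0) :
    Ext.homEquiv₀ (e.comp (Ext.mk₀ g) (add_zero 0)) = Ext.homEquiv₀ e ≫ g := by
  obtain ⟨f, rfl⟩ := Ext.homEquiv₀.symm.surjective e
  rw [Equiv.apply_symm_apply, ← Equiv.eq_symm_apply]
  exact Ext.mk₀_comp_mk₀ f g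

/-- Evaluation at `1` as a map from the direct limit of `Hom(R/𝔞^t, M)`. -/
def limExtZeroMap (M : ModuleCat.{u} R) : LimExt 𝔞 M 0 →ₗ[R] M :=
  Module.DirectLimit.lift R ℕ _ _
    (fun t => (Submodule.torsionBySet R M ((𝔞 ^ t : Ideal R) : Set R)).subtype ∘ₗ
      (extQuotZeroEquiv (𝔞 ^ t) M).toLinearMap) fun s t hst e => by
      change (extQuotZeroEquiv (𝔞 ^ t) M (extPowMap 𝔞 M 0 s t hst e) : M) =
        extQuotZeroEquiv (𝔞 ^ s) M e
      rw [extQuotZeroEquiv_apply, extQuotZeroEquiv_apply, extPowMap_apply, homEquiv₀_mk₀_comp]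
      rfl

lemma limExtZeroMap_of (t : ℕ) (e : Ext (ModuleCat.of R (R ⧸ 𝔞 ^ t)) M 0) :
    limExtZeroMap 𝔞 M (limExtOf 𝔞 M 0 t e) = extQuotZeroEquiv (𝔞 ^ t) M e :=
  Module.DirectLimit.lift_of _ _ _

lemma limExtZeroMap_injective (M : ModuleCat.{u} R) :
    Function.Injective (limExtZeroMap 𝔞 M) := by
  refine (injective_iff_map_eq_zero _).mpr fun z hz => ?_
  obtain ⟨t, e, rfl⟩ := exists_limExtOf 𝔞 z
  rw [limExtZeroMap_of] at hz
  rw [(extQuotZeroEquiv (𝔞 ^ t) M).map_eq_zero_iff.mp (Subtype.ext hz), map_zero]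

lemma range_limExtZeroMap (M : ModuleCat.{u} R) :
    LinearMap.range (limExtZeroMap 𝔞 M) = gamma 𝔞 M := by
  ext m
  constructor
  · rintro ⟨z, rfl⟩
    obtain ⟨t, e, rfl⟩ := exists_limExtOf 𝔞 z
    rw [limExtZeroMap_of]
    exact ⟨t, fun c hc => (Submodule.mem_torsionBySet_iff _ _).mp
      (extQuotZeroEquiv (𝔞 ^ t) M e).2 ⟨c, hc⟩⟩
  · rintro ⟨t, ht⟩
    refine ⟨limExtOf 𝔞 M 0 t ((extQuotZeroEquiv (𝔞 ^ t) M).symm ⟨m, ?_⟩), ?_⟩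
    · rw [Submodule.mem_torsionBySet_iff]
      exact fun c => ht c c.2
    · rw [limExtZeroMap_of, LinearEquiv.apply_symm_apply]

/-- In degree zero the direct limit is `Γ_𝔞(M)`. -/
def limExtZeroEquiv (M : ModuleCat.{u} R) : LimExt 𝔞 M 0 ≃ₗ[R] gamma 𝔞 M :=
  (LinearEquiv.ofInjective _ (limExtZeroMap_injective 𝔞 M)).trans
    (LinearEquiv.ofEq _ _ (range_limExtZeroMap 𝔞 M))

lemma limExtZeroMap_postcomp (f : M ⟶ N) (z : LimExt 𝔞 M 0) :
    limExtZeroMap 𝔞 N (limExtPostcomp 𝔞 (Ext.mk₀ f) (add_zero 0) z) = f (limExtZeroMap 𝔞 M z) := by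
  obtain ⟨t, e, rfl⟩ := exists_limExtOf 𝔞 z
  rw [limExtPostcomp_of, limExtZeroMap_of, limExtZeroMap_of, extQuotZeroEquiv_apply,
    extQuotZeroEquiv_apply, homEquiv₀_comp_mk₀]
  rfl

/-- Local cohomology in positive degree vanishes on `𝔞`-torsion modules. -/
theorem subsingleton_limExt_succ_of_torsion [IsNoetherianRing R] (T : ModuleCat.{u} R)
    (hT : gamma 𝔞 T = ⊤) (i : ℕ) : Subsingleton (LimExt 𝔞 T (i + 1)) := by
  induction i generalizing T with
  | zero =>
    obtain ⟨E, f, hf, hE, hE'⟩ := exists_injective_torsion_embedding hT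
    have : Injective E := Module.injective_object_of_injective_module R E
    have hS := shortExact_of_linearMap hf (LinearMap.exact_map_mkQ_range f)
      (Submodule.mkQ_surjective _)
    have : Subsingleton (LimExt 𝔞 E (0 + 1)) :=
      subsingleton_limExt 𝔞 fun t => Ext.subsingleton_of_injective _ _ 0
    refine subsingleton_of_forall_eq 0 fun z => ?_
    obtain ⟨w, rfl⟩ := (limExt_exact₁ 𝔞 hS 0 z).mp (Subsingleton.elim (α := LimExt 𝔞 E (0 + 1)) _ _)
    -- The connecting map is zero in degree zero: as `Γ_𝔞(E) = E`, every element of `E / T` lifts to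
    -- `Γ_𝔞(E)`.
    refine (limExt_exact₃ 𝔞 hS 0 w).mpr ?_
    obtain ⟨e, he⟩ := Submodule.mkQ_surjective _ (limExtZeroMap 𝔞 _ w)
    obtain ⟨y, hy⟩ : e ∈ LinearMap.range (limExtZeroMap 𝔞 E) := by
      rw [range_limExtZeroMap, hE']
      trivial
    refine ⟨y, limExtZeroMap_injective 𝔞 _ ?_⟩
    rw [limExtZeroMap_postcomp]
    exact (congrArg _ hy).trans he
  | succ i ih =>
    obtain ⟨E, f, hf, hE, hE'⟩ := exists_injective_torsion_embedding hT
    have : Injective E := Module.injective_object_of_injective_module R E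
    have hS := shortExact_of_linearMap hf (LinearMap.exact_map_mkQ_range f)
      (Submodule.mkQ_surjective _)
    have : Subsingleton (LimExt 𝔞 E (i + 1 + 1)) :=
      subsingleton_limExt 𝔞 fun t => Ext.subsingleton_of_injective _ _ (i + 1)
    have := ih (ModuleCat.of R (E ⧸ LinearMap.range f))
      (gamma_eq_top_of_surjective _ (Submodule.mkQ_surjective _) hE')
    refine subsingleton_of_forall_eq 0 fun z => ?_
    obtain ⟨w, rfl⟩ := (limExt_exact₁ 𝔞 hS (i + 1) z).mp
      (Subsingleton.elim (α := LimExt 𝔞 E (i + 1 + 1)) _ _)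
    rw [Subsingleton.elim (α := LimExt 𝔞 (ModuleCat.of R (E ⧸ LinearMap.range f)) (i + 1)) w 0,
      map_zero]

end LocalCohomology

/-! ### Cofiniteness of local cohomology -/

section Cofinite

open Abelian

variable {R : Type u} [CommRing R] {𝔞 : Ideal R}

lemma IsCofinite.congr {M N : Type u} [AddCommGroup M] [Module R M] [AddCommGroup N] [Module R N]
    (e : M ≃ₗ[R] N) (h : IsCofinite 𝔞 M) : IsCofinite 𝔞 N := by
  refine ⟨e.support_eq ▸ h.1, fun i => ?_⟩
  have := h.2 i
  refine Module.Finite.of_surjective ((Ext.mk₀ (ModuleCat.ofHom e.toLinearMap)).postcompOfLinear R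
    (ModuleCat.of R (R ⧸ 𝔞)) (add_zero i)) fun y => ?_
  refine ⟨y.comp (Ext.mk₀ (ModuleCat.ofHom e.symm.toLinearMap)) (add_zero i), ?_⟩
  have he : ModuleCat.ofHom e.symm.toLinearMap ≫ ModuleCat.ofHom e.toLinearMap = 𝟙 _ := by
    rw [← ModuleCat.ofHom_comp]
    ext x
    exact e.apply_symm_apply x
  change (y.comp (Ext.mk₀ (ModuleCat.ofHom e.symm.toLinearMap)) (add_zero i)).comp
    (Ext.mk₀ (ModuleCat.ofHom e.toLinearMap)) (add_zero i) = y
  rw [Ext.comp_assoc_of_third_deg_zero, Ext.mk₀_comp_mk₀, he, Ext.comp_mk₀_id]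

lemma support_subset_of_gamma_eq_top {M : Type u} [AddCommGroup M] [Module R M]
    (h : gamma 𝔞 M = ⊤) : Module.support R M ⊆ PrimeSpectrum.zeroLocus (𝔞 : Set R) := by
  intro p hp
  obtain ⟨m, hm⟩ := Module.mem_support_iff_exists_annihilator.mp hp
  obtain ⟨k, hk⟩ := mem_gamma.mp (h ▸ Submodule.mem_top : m ∈ gamma 𝔞 M)
  refine p.isPrime.le_of_pow_le (n := k) fun c hc => hm ?_
  rw [Submodule.mem_annihilator_span_singleton]
  exact hk c hc

/-- An `𝔞`-torsion module that is artinian with socle of finite length is `𝔞`-cofinite. -/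
lemma HasFiniteSocle.isCofinite [IsNoetherianRing R] {M : Type u} [AddCommGroup M] [Module R M]
    (h : HasFiniteSocle (𝔞 : Set R) M) (hM : gamma 𝔞 M = ⊤) : IsCofinite 𝔞 M := by
  refine ⟨support_subset_of_gamma_eq_top hM, fun i => ?_⟩
  have := (isFiniteLength_iff_isNoetherian_isArtinian.mp (h.isFiniteLength_extQuot i)).1
  infer_instance

/-- `Γ_𝔞(M)` is artinian and `𝔞`-cofinite if and only if `0 :_M 𝔞` has finite length. -/
theorem isArtinian_and_isCofinite_gamma_iff [IsNoetherianRing R] {M : Type u} [AddCommGroup M]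
    [Module R M] : IsArtinian R (gamma 𝔞 M) ∧ IsCofinite 𝔞 (gamma 𝔞 M) ↔
      IsFiniteLength R (Submodule.torsionBySet R M (𝔞 : Set R)) := by
  constructor
  · rintro ⟨h1, h2⟩
    -- Of cofiniteness only `Ext⁰` is needed: `0 :_Γ 𝔞` is finitely generated, and artinian as a
    -- submodule of `Γ`. It coincides with `0 :_M 𝔞`.
    have := h2.2 0
    have h3 : Module.Finite R (Submodule.torsionBySet R (gamma 𝔞 M) (𝔞 : Set R)) :=
      Module.Finite.equiv (extQuotZeroEquiv 𝔞 (ModuleCat.of R (gamma 𝔞 M)))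
    have h4 : IsFiniteLength R (Submodule.torsionBySet R (gamma 𝔞 M) (𝔞 : Set R)) :=
      isFiniteLength_iff_isNoetherian_isArtinian.mpr ⟨inferInstance, inferInstance⟩
    refine h4.of_surjective (f := torsionBySetMap _ (gamma 𝔞 M).subtype) ?_
    rintro ⟨m, hm⟩
    have hm' := (Submodule.mem_torsionBySet_iff _ _).mp hm
    refine ⟨⟨⟨m, 1, fun c hc => hm' ⟨c, by simpa using hc⟩⟩, ?_⟩, rfl⟩
    rw [Submodule.mem_torsionBySet_iff]
    exact fun c => Subtype.ext (hm' c)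
  · intro h
    have h' := hasFiniteSocle_gamma (IsNoetherian.noetherian 𝔞) h
    exact ⟨h'.1, h'.isCofinite gamma_gamma⟩

lemma isArtinian_and_isCofinite_congr {M N : Type u} [AddCommGroup M] [Module R M]
    [AddCommGroup N] [Module R N] (e : M ≃ₗ[R] N) :
    IsArtinian R M ∧ IsCofinite 𝔞 M ↔ IsArtinian R N ∧ IsCofinite 𝔞 N :=
  and_congr e.isArtinian_iff ⟨fun h => h.congr e, fun h => h.congr e.symm⟩

/-- Local cohomology being artinian and cofinite is subject to dévissage. -/
theorem devissage_limExt [IsNoetherianRing R] (𝔞 : Ideal R) :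
    Devissage 𝔞 fun i M => IsArtinian R (LimExt 𝔞 M i) ∧ IsCofinite 𝔞 (LimExt 𝔞 M i) where
  zero M := (isArtinian_and_isCofinite_congr (limExtZeroEquiv 𝔞 M)).trans
    isArtinian_and_isCofinite_gamma_iff
  shift S hS hE hE' i := by
    have hv : ∀ i, Subsingleton (LimExt 𝔞 S.X₂ i) := fun i => subsingleton_limExt 𝔞 fun t =>
      subsingleton_ext_of_injective_of_noTorsion _ (hE'.pow t) i
    exact (isArtinian_and_isCofinite_congr (linearEquivOfExact (limExt_exact₃ 𝔞 hS i)
      (limExt_exact₁ 𝔞 hS i) (hv i) (hv (i + 1)))).symm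
  quot M hM i := by
    have hv : ∀ i, Subsingleton (LimExt 𝔞 (ModuleCat.of R (gamma 𝔞 M)) (i + 1)) :=
      subsingleton_limExt_succ_of_torsion 𝔞 _ gamma_gamma
    exact isArtinian_and_isCofinite_congr (linearEquivOfExact
      (limExt_exact₂ 𝔞 (shortExact_gamma 𝔞 M) (i + 1))
      (limExt_exact₃ 𝔞 (shortExact_gamma 𝔞 M) (i + 1)) (hv i) (hv (i + 1)))

end Cofinite

end ArtCof

end

noncomputable section

namespace ArtCof

/-! ### The contracting homotopy on Koszul cochains -/

section KoszulHomotopy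

variable {R : Type u} [CommRing R] {r : ℕ} (x : Fin r → R) {M : Type u} [AddCommGroup M]
  [Module R M]

lemma koszulSign_mul_self (S : Finset (Fin r)) (s : Fin r) :
    koszulSign S s * koszulSign S s = 1 := by
  rw [koszulSign, ← mul_pow]
  simp

/-- The Koszul differential on ungraded cochains. -/
def koszulTotalD (Φ : Finset (Fin r) → M) (S : Finset (Fin r)) : M :=
  ∑ t ∈ S, koszulSign S t • x t • Φ (S.erase t)

/-- The contraction against the `s`-th basis vector on ungraded cochains. -/
def koszulTotalH (s : Fin r) (Φ : Finset (Fin r) → M) (S : Finset (Fin r)) : M :=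
  if s ∈ S then 0 else koszulSign (insert s S) s • Φ (insert s S)

/-- The contraction is a homotopy from multiplication by `x s` to zero. -/
lemma koszulTotal_homotopy (s : Fin r) (Φ : Finset (Fin r) → M) (S : Finset (Fin r)) :
    koszulTotalD x (koszulTotalH s Φ) S + koszulTotalH s (koszulTotalD x Φ) S = x s • Φ S := by
  by_cases hs : s ∈ S
  · rw [koszulTotalH, if_pos hs, add_zero, koszulTotalD, Finset.sum_eq_single s]
    · rw [koszulTotalH, if_neg (Finset.notMem_erase s S), Finset.insert_erase hs,
        smul_comm (x s), smul_smul, koszulSign_mul_self, one_smul]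
    · intro t _ hts
      rw [koszulTotalH, if_pos (Finset.mem_erase.mpr ⟨hts.symm, hs⟩), smul_zero, smul_zero]
    · exact fun h => absurd hs h
  · rw [koszulTotalH, if_neg hs]
    simp only [koszulTotalD]
    rw [Finset.sum_insert hs, Finset.erase_insert hs, smul_add, smul_smul, koszulSign_mul_self,
      one_smul, add_left_comm, Finset.smul_sum, ← Finset.sum_add_distrib,
      Finset.sum_eq_zero, add_zero]
    intro t ht
    have hst : s ≠ t := fun h => hs (h ▸ ht)
    have hins : insert s (S.erase t) = (insert s S).erase t := by
      rw [Finset.erase_insert_of_ne hst]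
    have key := koszulSign_swap (insert s S) (Finset.mem_insert_self s S)
      (Finset.mem_insert_of_mem ht) hst
    rw [Finset.erase_insert hs] at key
    rw [koszulTotalH, if_neg fun h => hs (Finset.mem_of_mem_erase h), hins,
      smul_comm (x t), smul_smul, smul_smul, ← add_smul]
    have h1 := koszulSign_mul_self (insert s S) s
    have h2 := koszulSign_mul_self ((insert s S).erase t) s
    have : koszulSign S t * koszulSign ((insert s S).erase t) s +
        koszulSign (insert s S) s * koszulSign (insert s S) t = 0 := by
      -- Signs square to `1`, so multiplying the anticommutation relation `key` by two of them moves
      -- them to the other factors.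
      linear_combination (koszulSign (insert s S) s * koszulSign ((insert s S).erase t) s) * key
        - (koszulSign S t * koszulSign ((insert s S).erase t) s) * h1
        - (koszulSign (insert s S) s * koszulSign (insert s S) t) * h2
    rw [this, zero_smul]

/-- Extension by zero of a Koszul cochain. -/
def koszulTotal {i : ℕ} (φ : KoszulCochain r M i) (S : Finset (Fin r)) : M :=
  if h : S.card = i then φ ⟨S, h⟩ else 0

lemma koszulTotal_apply {i : ℕ} (φ : KoszulCochain r M i) (S : {S : Finset (Fin r) // S.card = i}) :
    koszulTotal φ S.1 = φ S := dif_pos S.2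

lemma koszulTotal_koszulD {i : ℕ} (φ : KoszulCochain r M i) :
    koszulTotal (koszulD x M i φ) = koszulTotalD x (koszulTotal φ) := by
  funext S
  by_cases h : S.card = i + 1
  · rw [koszulTotal, dif_pos h, koszulTotalD, ← Finset.sum_coe_sort]
    refine Finset.sum_congr rfl fun t _ => ?_
    rw [koszulTotal, dif_pos]
  · rw [koszulTotal, dif_neg h, koszulTotalD, Finset.sum_eq_zero]
    intro t ht
    rw [koszulTotal, dif_neg, smul_zero, smul_zero]
    have := Finset.card_erase_add_one ht
    lia

/-- On a cocycle the homotopy formula reduces to `d (h φ) = x_s φ`. The extension by zero to all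
subsets lets the formula be proved without tracking degrees. -/
lemma exists_koszulD_eq_smul {i : ℕ} {φ : KoszulCochain r M (i + 1)}
    (hφ : koszulD x M (i + 1) φ = 0) (s : Fin r) : ∃ ψ, koszulD x M i ψ = x s • φ := by
  let ψ : KoszulCochain r M i := fun S => koszulTotalH s (koszulTotal φ) S.1
  have hψ : koszulTotal ψ = koszulTotalH s (koszulTotal φ) := by
    funext S
    by_cases h : S.card = i
    · exact dif_pos h
    · rw [koszulTotal, dif_neg h, koszulTotalH]
      split_ifs with hs
      · rfl
      · rw [koszulTotal, dif_neg, smul_zero]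
        rw [Finset.card_insert_of_notMem hs]
        lia
  refine ⟨ψ, funext fun S => ?_⟩
  have h1 := koszulTotal_homotopy x s (koszulTotal φ) S.1
  rw [← hψ, ← koszulTotal_koszulD, ← koszulTotal_koszulD, hφ, koszulTotal_apply,
    koszulTotal_apply] at h1
  rw [Pi.smul_apply, ← h1, koszulTotalH]
  simp [koszulTotal]

lemma smul_eq_zero_of_koszulD_eq_zero {φ : KoszulCochain r M 0}
    (hφ : koszulD x M 0 φ = 0) (s : Fin r) : x s • φ = 0 := by
  funext S
  have h1 := koszulTotal_homotopy x s (koszulTotal φ) S.1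
  rw [← koszulTotal_koszulD, hφ, koszulTotal_apply] at h1
  rw [Pi.smul_apply, ← h1, koszulTotalH, koszulTotalD, Finset.card_eq_zero.mp S.2]
  simp [koszulTotal]

end KoszulHomotopy

/-! ### Koszul exactness for torsion-free injective modules -/

section KoszulInjective

variable {R : Type u} [CommRing R] {r : ℕ} (x : Fin r → R) {M : Type u} [AddCommGroup M]
  [Module R M]

lemma koszulD_comp {N : Type u} [AddCommGroup N] [Module R N] (f : M →ₗ[R] N) {i : ℕ}
    (φ : KoszulCochain r M i) : koszulD x N i (fun S => f (φ S)) =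
      fun S => f (koszulD x M i φ S) := by
  funext S
  simp [koszulD, map_sum]

/-- The pairing of a Koszul cochain with a Koszul chain. -/
def koszulPairing {i : ℕ} (φ : KoszulCochain r M i) : KoszulCochain r R i →ₗ[R] M :=
  ∑ S, (LinearMap.proj S : KoszulCochain r R i →ₗ[R] R).smulRight (φ S)

lemma koszulPairing_apply {i : ℕ} (φ : KoszulCochain r M i) (c : KoszulCochain r R i) :
    koszulPairing φ c = ∑ S, c S • φ S := by
  simp [koszulPairing]

lemma koszulPairing_single {i : ℕ} (φ : KoszulCochain r M i)
    (S : {S : Finset (Fin r) // S.card = i}) :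
    koszulPairing φ (Pi.single S (1 : R)) = φ S := by
  rw [koszulPairing_apply, Finset.sum_eq_single S]
  · simp
  · intro T _ hT
    rw [Pi.single_eq_of_ne hT, zero_smul]
  · simp

/-- The Koszul differential on chains, as the transpose of the one on cochains. -/
def koszulBoundary (i : ℕ) : KoszulCochain r R (i + 1) →ₗ[R] KoszulCochain r R i :=
  LinearMap.pi fun T => koszulPairing (koszulD x R i (Pi.single T 1))

/-- The boundary is the transpose of the differential over `R`. The case of coefficients in `M`
follows by writing `φ` as a sum of basis cochains pushed forward along maps `R → M`. -/
lemma koszulPairing_koszulD {i : ℕ} (φ : KoszulCochain r M i) (c : KoszulCochain r R (i + 1)) :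
    koszulPairing (koszulD x M i φ) c = koszulPairing φ (koszulBoundary x i c) := by
  have hφ : φ = ∑ T, fun S => (LinearMap.toSpanSingleton R M (φ T))
      ((Pi.single T 1 : KoszulCochain r R i) S) := by
    funext S
    rw [Finset.sum_apply, Finset.sum_eq_single S]
    · simp
    · intro T _ hT
      rw [Pi.single_eq_of_ne hT.symm, map_zero]
    · simp
  rw [koszulPairing_apply, koszulPairing_apply]
  conv_lhs => rw [hφ]
  simp only [map_sum, Finset.sum_apply, Finset.smul_sum, koszulBoundary,
    LinearMap.pi_apply, koszulPairing_apply, LinearMap.toSpanSingleton_apply, Finset.sum_smul]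
  rw [Finset.sum_comm]
  refine Finset.sum_congr rfl fun T _ => Finset.sum_congr rfl fun S _ => ?_
  rw [smul_assoc]
  exact congrArg (c S • ·) (congrFun (koszulD_comp x (LinearMap.toSpanSingleton R M (φ T))
    (Pi.single T 1)) S)

/-- The Koszul complex of an injective module without `𝔞`-torsion is exact. -/
lemma exists_koszulD_eq_of_injective [Module.Injective R M]
    (hM : NoTorsion (Ideal.span (Set.range x)) M) {i : ℕ} {φ : KoszulCochain r M (i + 1)}
    (hφ : koszulD x M (i + 1) φ = 0) : ∃ ψ, koszulD x M i ψ = φ := by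
  -- Each `x_s φ` is a coboundary, so it pairs to zero with any cycle `c`. The value of `φ` on `c`
  -- is thus killed by the ideal and vanishes.
  have hker : LinearMap.ker (koszulBoundary x i) ≤ LinearMap.ker (koszulPairing φ) := by
    intro c hc
    refine hM _ fun a ha => ?_
    have : Ideal.span (Set.range x) ≤
        LinearMap.ker (LinearMap.toSpanSingleton R M (koszulPairing φ c)) := by
      rw [Ideal.span_le]
      rintro _ ⟨s, rfl⟩
      obtain ⟨ψ, hψ⟩ := exists_koszulD_eq_smul x hφ s
      have h1 := koszulPairing_koszulD x ψ c
      rw [hψ, LinearMap.mem_ker.mp hc, map_zero, koszulPairing_apply] at h1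
      change x s • koszulPairing φ c = 0
      rw [koszulPairing_apply, Finset.smul_sum, ← h1]
      exact Finset.sum_congr rfl fun S _ => smul_comm _ _ _
    exact this ha
  -- The pairing with `φ` descends to the boundaries and extends, by injectivity, to all chains of
  -- degree `i`. The values on the basis form the required `ψ`.
  obtain ⟨g, hg⟩ := Module.Injective.out
    ((LinearMap.ker (koszulBoundary x i)).liftQ (koszulBoundary x i) le_rfl)
    (LinearMap.ker_eq_bot.mp (Submodule.ker_liftQ_eq_bot' _ _ rfl))
    ((LinearMap.ker (koszulBoundary x i)).liftQ (koszulPairing φ) hker)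
  have hg' : ∀ c, g (koszulBoundary x i c) = koszulPairing φ c := fun c =>
    hg (Submodule.Quotient.mk c)
  let ψ : KoszulCochain r M i := fun T => g (Pi.single T 1)
  have hψ : koszulPairing ψ = g := by
    refine LinearMap.pi_ext' fun T => LinearMap.ext_ring ?_
    exact koszulPairing_single ψ T
  refine ⟨ψ, funext fun S => ?_⟩
  rw [← koszulPairing_single (R := R) (koszulD x M i ψ) S, koszulPairing_koszulD, hψ, hg',
    koszulPairing_single]

end KoszulInjective

/-! ### Koszul cohomology: long exact sequence and dévissage -/

section KoszulCohomology

variable {R : Type u} [CommRing R] {r : ℕ} (x : Fin r → R)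

lemma koszulComplex_d (M : Type u) [AddCommGroup M] [Module R M] (i : ℕ) :
    (koszulComplex x M).d i (i + 1) = ModuleCat.ofHom (koszulD x M i) :=
  CochainComplex.of_d (fun i => ModuleCat.of R (KoszulCochain r M i))
    (fun i => ModuleCat.ofHom (koszulD x M i)) i

/-- The map of Koszul complexes induced by a linear map. -/
def koszulMap {M N : Type u} [AddCommGroup M] [Module R M] [AddCommGroup N] [Module R N]
    (f : M →ₗ[R] N) : koszulComplex x M ⟶ koszulComplex x N :=
  CochainComplex.ofHom (X := koszulComplex x M) (Y := koszulComplex x N)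
    (fun i => ModuleCat.ofHom (f.compLeft {S : Finset (Fin r) // S.card = i})) fun i => by
      rw [koszulComplex_d, koszulComplex_d]
      refine ModuleCat.hom_ext (LinearMap.ext fun φ => ?_)
      exact koszulD_comp x f φ

variable {S : ShortComplex (ModuleCat.{u} R)}

/-- The short complex of Koszul complexes induced by a short complex of modules. -/
def koszulShortComplex (S : ShortComplex (ModuleCat.{u} R)) :
    ShortComplex (CochainComplex (ModuleCat.{u} R) ℕ) :=
  ShortComplex.mk (koszulMap x S.f.hom) (koszulMap x S.g.hom) (by
    ext i φ
    refine funext fun T => ?_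
    exact S.moduleCat_zero_apply (φ T))

lemma koszulShortComplex_shortExact (hS : S.ShortExact) :
    (koszulShortComplex x S).ShortExact := by
  refine HomologicalComplex.shortExact_of_degreewise_shortExact _ fun i => ?_
  have hf := hS.moduleCat_injective_f
  have hg := hS.moduleCat_surjective_g
  have hfg := (ShortComplex.ShortExact.moduleCat_exact_iff_function_exact S).mp hS.exact
  refine shortExact_of_linearMap (f := S.f.hom.compLeft {S : Finset (Fin r) // S.card = i})
    (g := S.g.hom.compLeft {S : Finset (Fin r) // S.card = i}) ?_ ?_ ?_
  · exact fun a b h => funext fun T => hf (congrFun h T)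
  · intro φ
    constructor
    · intro h
      choose ψ hψ using fun T => (hfg (φ T)).mp (congrFun h T)
      exact ⟨ψ, funext hψ⟩
    · rintro ⟨ψ, rfl⟩
      exact funext fun T => hfg.apply_apply_eq_zero (ψ T)
  · intro φ
    choose ψ hψ using fun T => hg (φ T)
    exact ⟨ψ, funext hψ⟩

lemma koszul_exact₂ (hS : S.ShortExact) (i : ℕ) : Function.Exact
    (HomologicalComplex.homologyMap (koszulMap x S.f.hom) i).hom
    (HomologicalComplex.homologyMap (koszulMap x S.g.hom) i).hom :=
  (ShortComplex.ShortExact.moduleCat_exact_iff_function_exact _).mp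
    ((koszulShortComplex_shortExact x hS).homology_exact₂ i)

lemma koszul_exact₃ (hS : S.ShortExact) (i : ℕ) : Function.Exact
    (HomologicalComplex.homologyMap (koszulMap x S.g.hom) i).hom
    ((koszulShortComplex_shortExact x hS).δ i (i + 1) rfl).hom :=
  (ShortComplex.ShortExact.moduleCat_exact_iff_function_exact _).mp
    ((koszulShortComplex_shortExact x hS).homology_exact₃ i (i + 1) rfl)

lemma koszul_exact₁ (hS : S.ShortExact) (i : ℕ) : Function.Exact
    ((koszulShortComplex_shortExact x hS).δ i (i + 1) rfl).hom
    (HomologicalComplex.homologyMap (koszulMap x S.f.hom) (i + 1)).hom :=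
  (ShortComplex.ShortExact.moduleCat_exact_iff_function_exact _).mp
    ((koszulShortComplex_shortExact x hS).homology_exact₁ i (i + 1) rfl)

variable (M : Type u) [AddCommGroup M] [Module R M] (i : ℕ)

/-- The cochain underlying a Koszul cocycle. -/
def koszulCocycle : (koszulComplex x M).cycles i →ₗ[R] KoszulCochain r M i :=
  ((koszulComplex x M).iCycles i).hom

lemma koszulCocycle_injective : Function.Injective (koszulCocycle x M i) :=
  iCycles_injective (koszulComplex x M) i

lemma koszulD_koszulCocycle (z : (koszulComplex x M).cycles i) :
    koszulD x M i (koszulCocycle x M i z) = 0 := by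
  have h := d_iCycles_apply (koszulComplex x M) i (i + 1) z
  rw [koszulComplex_d] at h
  exact h

variable {M i} in
lemma exists_koszulCocycle_eq {φ : KoszulCochain r M i} (hφ : koszulD x M i φ = 0) :
    ∃ z, koszulCocycle x M i z = φ :=
  exists_iCycles_eq (koszulComplex x M) (j := i + 1) (by simp) φ (by
    rw [koszulComplex_d]
    exact hφ)

variable {M i} in
lemma koszul_homologyπ_eq_zero {z : (koszulComplex x M).cycles (i + 1)} {ψ : KoszulCochain r M i}
    (h : koszulD x M i ψ = koszulCocycle x M (i + 1) z) :
    (koszulComplex x M).homologyπ (i + 1) z = 0 :=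
  homologyπ_eq_zero_of_d (koszulComplex x M) (i := i) z ψ (by
    rw [koszulComplex_d]
    exact h)

/-- Koszul cohomology is killed by the ideal generated by the sequence. -/
lemma koszulCohomology_smul_eq_zero {c : R} (hc : c ∈ Ideal.span (Set.range x))
    (w : koszulCohomology x M i) : c • w = 0 := by
  suffices h : Ideal.span (Set.range x) ≤
      LinearMap.ker (LinearMap.toSpanSingleton R (koszulCohomology x M i) w) from h hc
  rw [Ideal.span_le]
  rintro _ ⟨s, rfl⟩
  change x s • w = 0
  obtain ⟨z, rfl⟩ := homologyπ_surjective (koszulComplex x M) i w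
  refine (map_smul ((koszulComplex x M).homologyπ i).hom (x s) z).symm.trans ?_
  cases i with
  | zero =>
    have : x s • z = 0 := koszulCocycle_injective x M 0 (by
      rw [map_smul, map_zero]
      exact smul_eq_zero_of_koszulD_eq_zero x (koszulD_koszulCocycle x M 0 z) s)
    rw [this, map_zero]
    rfl
  | succ i =>
    obtain ⟨ψ, hψ⟩ := exists_koszulD_eq_smul x (koszulD_koszulCocycle x M (i + 1) z) s
    exact koszul_homologyπ_eq_zero x (ψ := ψ) (by rw [hψ, map_smul])

/-- In degree zero Koszul cohomology is `0 :_M 𝔞`. -/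
lemma isFiniteLength_koszulCohomology_zero_iff : IsFiniteLength R (koszulCohomology x M 0) ↔
    IsFiniteLength R (Submodule.torsionBySet R M (Ideal.span (Set.range x) : Set R)) := by
  have hπ : Function.Bijective ((koszulComplex x M).homologyπ 0).hom := by
    refine ⟨(injective_iff_map_eq_zero _).mpr fun z hz => ?_, homologyπ_surjective _ 0⟩
    obtain ⟨y, hy⟩ := exists_d_eq_of_homologyπ_eq_zero (koszulComplex x M) (i := 0) (by simp) z hz
    refine iCycles_injective _ _ ?_
    rw [← hy, HomologicalComplex.shape _ _ _ (by simp), map_zero]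
    rfl
  let e₁ := LinearEquiv.ofBijective _ hπ
  let ev : (koszulComplex x M).cycles 0 →ₗ[R] M :=
    LinearMap.proj ⟨∅, Finset.card_empty⟩ ∘ₗ koszulCocycle x M 0
  have hev : ∀ S : {S : Finset (Fin r) // S.card = 0}, S = ⟨∅, Finset.card_empty⟩ :=
    fun S => Subtype.ext (Finset.card_eq_zero.mp S.2)
  have hinj : Function.Injective ev := fun a b h => koszulCocycle_injective x M 0
    (funext fun S => by rw [hev S]; exact h)
  have hrange : LinearMap.range ev =
      Submodule.torsionBySet R M (Ideal.span (Set.range x) : Set R) := by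
    rw [← torsionBySet_eq_of_span_eq rfl]
    ext m
    rw [Submodule.mem_torsionBySet_iff]
    constructor
    · rintro ⟨z, rfl⟩ ⟨_, s, rfl⟩
      exact congrFun (smul_eq_zero_of_koszulD_eq_zero x (koszulD_koszulCocycle x M 0 z) s) _
    · intro hm
      obtain ⟨z, hz⟩ := exists_koszulCocycle_eq x (φ := fun _ : {S : Finset (Fin r) // S.card = 0} => m) (by
        funext S
        refine Finset.sum_eq_zero fun s _ => ?_
        rw [hm ⟨x s.1, s.1, rfl⟩, smul_zero])
      exact ⟨z, congrFun hz _⟩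
  let e₂ := (LinearEquiv.ofInjective ev hinj).trans (LinearEquiv.ofEq _ _ hrange)
  exact ⟨fun h => (e₁.symm.trans e₂).isFiniteLength h, fun h => (e₂.symm.trans e₁).isFiniteLength h⟩

lemma subsingleton_koszulCohomology [Module.Injective R M]
    (hM : NoTorsion (Ideal.span (Set.range x)) M) : Subsingleton (koszulCohomology x M i) := by
  refine subsingleton_of_forall_eq 0 fun w => ?_
  obtain ⟨z, rfl⟩ := homologyπ_surjective (koszulComplex x M) i w
  cases i with
  | zero =>
    have : z = 0 := koszulCocycle_injective x M 0 (by
      rw [map_zero]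
      funext S
      refine hM _ fun c hc => ?_
      suffices h : Ideal.span (Set.range x) ≤
          LinearMap.ker (LinearMap.toSpanSingleton R M (koszulCocycle x M 0 z S)) from h hc
      rw [Ideal.span_le]
      rintro _ ⟨s, rfl⟩
      exact congrFun (smul_eq_zero_of_koszulD_eq_zero x (koszulD_koszulCocycle x M 0 z) s) S)
    rw [this, map_zero]
    rfl
  | succ i =>
    obtain ⟨ψ, hψ⟩ := exists_koszulD_eq_of_injective x hM (koszulD_koszulCocycle x M (i + 1) z)
    exact koszul_homologyπ_eq_zero x hψ

variable {M} in
-- Koszul cohomology is a subquotient of a finite power of `M`, so it stays in the class, and it is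
-- killed by the ideal.
lemma HasFiniteSocle.isFiniteLength_koszulCohomology
    (hM : HasFiniteSocle (Ideal.span (Set.range x) : Set R) M) :
    IsFiniteLength R (koszulCohomology x M i) := by
  have h1 : HasFiniteSocle (Ideal.span (Set.range x) : Set R) (KoszulCochain r M i) := hM.pi
  have h2 := h1.of_injective _ (koszulCocycle_injective x M i)
  refine HasFiniteSocle.isFiniteLength (𝔞 := Ideal.span (Set.range x)) ?_
    fun c hc w => koszulCohomology_smul_eq_zero x M i hc w
  exact h2.of_surjective_of_fg (Submodule.fg_span (Set.finite_range x))
    ((koszulComplex x M).homologyπ i).hom (homologyπ_surjective _ i)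

/-- The Koszul cohomology modules having finite length is subject to dévissage. -/
theorem devissage_koszulCohomology : Devissage (Ideal.span (Set.range x))
    fun i (M : ModuleCat.{u} R) => IsFiniteLength R (koszulCohomology x M i) where
  zero M := isFiniteLength_koszulCohomology_zero_iff x M
  shift S hS hE hE' i := by
    have : Module.Injective R S.X₂ := Module.injective_module_of_injective_object R S.X₂
    have e := linearEquivOfExact (koszul_exact₃ x hS i) (koszul_exact₁ x hS i)
      (subsingleton_koszulCohomology x S.X₂ i hE') (subsingleton_koszulCohomology x S.X₂ (i + 1) hE')
    exact ⟨fun h => e.symm.isFiniteLength h, fun h => e.isFiniteLength h⟩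
  quot M hM i := by
    have hΓ := hasFiniteSocle_gamma (Submodule.fg_span (Set.finite_range x)) hM
    exact isFiniteLength_iff_of_exact (koszul_exact₂ x (shortExact_gamma _ M) (i + 1))
      (koszul_exact₃ x (shortExact_gamma _ M) (i + 1))
      (hΓ.isFiniteLength_koszulCohomology x (i + 1))
      (hΓ.isFiniteLength_koszulCohomology x (i + 1 + 1))

end KoszulCohomology

end ArtCof

end

noncomputable section

namespace ArtCof

/-! ### Filter-regular sequences -/

section FilterRegular

open Abelian

variable {R : Type u} [CommRing R]

lemma IsFilterRegular.of_injective {M N : Type u} [AddCommGroup M] [Module R M] [AddCommGroup N]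
    [Module R N] {y : R} (f : M →ₗ[R] N) (hf : Function.Injective f) (h : IsFilterRegular N y) :
    IsFilterRegular M y := by
  refine IsFiniteLength.of_injective h (f := f.restrict (p := Submodule.torsionBy R M y)
    (q := Submodule.torsionBy R N y) fun m (hm : y • m = 0) =>
      show y • f m = 0 by rw [← map_smul, hm, map_zero]) ?_
  exact fun a b hab => Subtype.ext (hf (congrArg Subtype.val hab))

lemma isFilterRegular_congr {M N : Type u} [AddCommGroup M] [Module R M] [AddCommGroup N]
    [Module R N] {y : R} (e : M ≃ₗ[R] N) : IsFilterRegular M y ↔ IsFilterRegular N y :=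
  ⟨fun h => h.of_injective e.symm.toLinearMap e.symm.injective,
    fun h => h.of_injective e.toLinearMap e.injective⟩

/-- The third isomorphism theorem identifies the successive quotients, which allows induction on the
length by removing the first element. -/
lemma isFilterRegularSeq_succ_iff {M : Type u} [AddCommGroup M] [Module R M] {n : ℕ}
    (y : Fin (n + 1) → R) : IsFilterRegularSeq M y ↔ IsFilterRegular M (y 0) ∧
      IsFilterRegularSeq (M ⧸ (Ideal.span {y 0} • (⊤ : Submodule R M))) (Fin.tail y) := by
  rw [IsFilterRegularSeq, Fin.forall_fin_succ]
  refine and_congr (isFilterRegular_congr ?_) (forall_congr' fun j => isFilterRegular_congr ?_)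
  · refine Submodule.quotEquivOfEqBot _ ?_
    have : {k : Fin (n + 1) | k < 0} = ∅ := by
      ext k
      simp
    rw [this, Set.image_empty, Ideal.span_empty, Submodule.bot_smul]
  · have hset : y '' {k | k < j.succ} = {y 0} ∪ Fin.tail y '' {k | k < j} := by
      ext c
      constructor
      · rintro ⟨k, hk, rfl⟩
        cases k using Fin.cases with
        | zero => exact Or.inl rfl
        | succ k => exact Or.inr ⟨k, Fin.succ_lt_succ_iff.mp hk, rfl⟩
      · rintro (rfl | ⟨k, hk, rfl⟩)
        · exact ⟨0, Fin.succ_pos j, rfl⟩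
        · exact ⟨k.succ, Fin.succ_lt_succ_iff.mpr hk, rfl⟩
    refine (Submodule.quotEquivOfEq _ _ ?_).trans
      ((Submodule.quotientQuotientEquivQuotientSup (Ideal.span {y 0} • (⊤ : Submodule R M))
        (Ideal.span (Fin.tail y '' {k | k < j}) • ⊤)).symm.trans (Submodule.quotEquivOfEq _ _ ?_))
    · rw [hset, Ideal.span_union, Submodule.sup_smul]
    · rw [Submodule.map_smul'', Submodule.map_top, Submodule.range_mkQ]

variable (M : Type u) [AddCommGroup M] [Module R M] (y : R)

/-- Multiplication by `y` as a map onto `y M`. -/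
def smulOnto : M →ₗ[R] (Ideal.span {y} • (⊤ : Submodule R M) : Submodule R M) :=
  (LinearMap.lsmul R M y).codRestrict _ fun _ =>
    Submodule.smul_mem_smul (Ideal.mem_span_singleton_self y) trivial

lemma smulOnto_surjective : Function.Surjective (smulOnto M y) := by
  rintro ⟨m, hm⟩
  rw [Submodule.ideal_span_singleton_smul] at hm
  obtain ⟨m', -, rfl⟩ := hm
  exact ⟨m', rfl⟩

lemma shortExact_torsionBy : (ShortComplex.mk
    (ModuleCat.ofHom (Submodule.torsionBy R M y).subtype) (ModuleCat.ofHom (smulOnto M y))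
    (ModuleCat.hom_ext (LinearMap.ext fun m => Subtype.ext m.2))).ShortExact := by
  refine shortExact_of_linearMap (Submodule.subtype_injective _) (fun m => ?_)
    (smulOnto_surjective M y)
  constructor
  · intro h
    exact ⟨⟨m, congrArg Subtype.val h⟩, rfl⟩
  · rintro ⟨m, rfl⟩
    exact Subtype.ext m.2

lemma shortExact_smul_top : (ShortComplex.mk
    (ModuleCat.ofHom (Ideal.span {y} • (⊤ : Submodule R M)).subtype)
    (ModuleCat.ofHom (Ideal.span {y} • (⊤ : Submodule R M)).mkQ)
    (by rw [← ModuleCat.ofHom_comp,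
        (LinearMap.exact_subtype_mkQ _).linearMap_comp_eq_zero]; rfl)).ShortExact :=
  shortExact_of_linearMap (Submodule.subtype_injective _) (LinearMap.exact_subtype_mkQ _)
    (Submodule.mkQ_surjective _)

/-- Multiplication by `y` factors as `M → yM → M`; this links the long exact sequences of `0 :_M y →
M → yM` and `yM → M → M/yM`. -/
lemma smulOnto_comp_subtype : ModuleCat.ofHom (smulOnto M y) ≫
    ModuleCat.ofHom (Ideal.span {y} • (⊤ : Submodule R M)).subtype =
      y • 𝟙 (ModuleCat.of R M) := rfl

variable {M y}

lemma hasFiniteSocle_of_isFiniteLength {N : Type u} [AddCommGroup N] [Module R N] (s : Set R)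
    (h : IsFiniteLength R N) : HasFiniteSocle s N := by
  obtain ⟨_, _⟩ := isFiniteLength_iff_isNoetherian_isArtinian.mp h
  exact ⟨inferInstance, inferInstance⟩

/-- Finite length of `Extⁱ(R/𝔞, M)` follows from that of `Extⁱ⁻¹(R/𝔞, M/yM)` when `y ∈ 𝔞` is
filter-regular on `M`. -/
lemma isFiniteLength_extQuot_succ [IsNoetherianRing R] {𝔞 : Ideal R} (hy : y ∈ 𝔞)
    (hreg : IsFilterRegular M y) {i : ℕ}
    (h : IsFiniteLength R (ExtQuot 𝔞 (M ⧸ (Ideal.span {y} • (⊤ : Submodule R M))) i)) :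
    IsFiniteLength R (ExtQuot 𝔞 M (i + 1)) := by
  have h₁ := shortExact_torsionBy M y
  have h₂ := shortExact_smul_top M y
  let X := ModuleCat.of R (R ⧸ 𝔞)
  let p := (Ext.mk₀ (ModuleCat.ofHom (smulOnto M y))).postcompOfLinear R X (add_zero (i + 1))
  let q := (Ext.mk₀
    (ModuleCat.ofHom (Ideal.span {y} • (⊤ : Submodule R M)).subtype)).postcompOfLinear R X
      (add_zero (i + 1))
  let δ := h₂.extClass.postcompOfLinear R X (rfl : i + 1 = i + 1)
  have hqp : ∀ e, q (p e) = 0 := fun e => by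
    change (e.comp (Ext.mk₀ (ModuleCat.ofHom (smulOnto M y))) (add_zero _)).comp (Ext.mk₀
      (ModuleCat.ofHom (Ideal.span {y} • (⊤ : Submodule R M)).subtype)) (add_zero _) = 0
    rw [Ext.comp_assoc_of_third_deg_zero, Ext.mk₀_comp_mk₀, smulOnto_comp_subtype, Ext.mk₀_smul,
      Ext.comp_smul, Ext.comp_mk₀_id]
    exact ext_smul_eq_zero _ _ hy e
  -- Since `y` kills `Ext(R/𝔞, M)`, the image of `p` lies in that of `Extⁱ(R/𝔞, M/yM)`. The kernel
  -- of `p` is an image of `Ext(R/𝔞, 0 :_M y)`; both have finite length.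
  have hδ : ∀ e, p e ∈ LinearMap.range δ := fun e => (ext_exact₁ X h₂ i (p e)).mp (hqp e)
  have hrange : IsFiniteLength R (LinearMap.range δ) :=
    IsFiniteLength.of_surjective h (f := δ.rangeRestrict) δ.surjective_rangeRestrict
  refine isFiniteLength_of_exact (g := p.codRestrict _ hδ)
    (f := (Ext.mk₀ (ModuleCat.ofHom (Submodule.torsionBy R M y).subtype)).postcompOfLinear R X
      (add_zero (i + 1))) (fun e => ?_)
    ((hasFiniteSocle_of_isFiniteLength _ hreg).isFiniteLength_extQuot (i + 1)) hrange
  exact Iff.trans ⟨fun h => congrArg Subtype.val h, fun h => Subtype.ext h⟩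
    (ext_exact₂ X h₁ (i + 1) e)

theorem isFiniteLength_extQuot_of_isFilterRegularSeq [IsNoetherianRing R] {𝔞 : Ideal R} {n : ℕ}
    (y : Fin n → R) (hy : ∀ j, y j ∈ 𝔞) (h : IsFilterRegularSeq M y) :
    ∀ i < n, IsFiniteLength R (ExtQuot 𝔞 M i) := by
  induction n generalizing M with
  | zero => exact fun i hi => absurd hi (Nat.not_lt_zero i)
  | succ n ih =>
    obtain ⟨h0, h1⟩ := (isFilterRegularSeq_succ_iff y).mp h
    intro i hi
    cases i with
    | zero =>
      refine (extQuotZeroEquiv 𝔞 (ModuleCat.of R M)).symm.isFiniteLength ?_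
      refine IsFiniteLength.of_injective h0 (f := Submodule.inclusion fun m hm =>
        (Submodule.mem_torsionBySet_iff _ _).mp hm ⟨y 0, hy 0⟩) (Submodule.inclusion_injective _)
    | succ i =>
      exact isFiniteLength_extQuot_succ (hy 0) h0
        (ih (Fin.tail y) (fun j => hy j.succ) h1 i (Nat.lt_of_succ_lt_succ hi))

/-- If `Γ_𝔞(M)` is artinian and `M` is finitely generated, then `𝔞` contains an element that is
filter-regular on `M`, with `𝔞`-torsion annihilator. -/
lemma exists_isFilterRegular [IsNoetherianRing R] [Module.Finite R M] {𝔞 : Ideal R}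
    (h : IsArtinian R (gamma 𝔞 M)) :
    ∃ y ∈ 𝔞, IsFilterRegular M y ∧ Submodule.torsionBy R M y ≤ gamma 𝔞 M := by
  have hsub : Subsingleton ((R ⧸ 𝔞) →ₗ[R] (M ⧸ gamma 𝔞 M)) := by
    refine (homQuotEquiv 𝔞 (M ⧸ gamma 𝔞 M)).toEquiv.subsingleton_congr.mpr ?_
    refine subsingleton_of_forall_eq 0 fun m => Subtype.ext ?_
    exact noTorsion_quotient_gamma (IsNoetherian.noetherian 𝔞) _ fun c hc =>
      (Submodule.mem_torsionBySet_iff _ _).mp m.2 ⟨c, hc⟩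
  -- For finitely generated modules, `Hom(R/𝔞, M/Γ_𝔞(M)) = 0` yields a regular element in the
  -- annihilator of `R/𝔞`, which is `𝔞`.
  obtain ⟨y, hy, hreg⟩ := IsSMulRegular.subsingleton_linearMap_iff.mp hsub
  rw [Ideal.annihilator_quotient] at hy
  have hle : Submodule.torsionBy R M y ≤ gamma 𝔞 M := by
    intro m hm
    refine (Submodule.Quotient.mk_eq_zero _).mp (hreg ?_)
    change y • Submodule.Quotient.mk m = y • 0
    rw [← Submodule.Quotient.mk_smul, show y • m = 0 from hm, smul_zero,
      Submodule.Quotient.mk_zero]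
  refine ⟨y, hy, ?_, hle⟩
  have : IsFiniteLength R (gamma 𝔞 M) :=
    isFiniteLength_iff_isNoetherian_isArtinian.mpr ⟨inferInstance, h⟩
  exact this.of_injective (f := Submodule.inclusion hle) (Submodule.inclusion_injective hle)

lemma isArtinian_of_exact {A B C : Type u} [AddCommGroup A] [Module R A] [AddCommGroup B]
    [Module R B] [AddCommGroup C] [Module R C] {f : A →ₗ[R] B} {g : B →ₗ[R] C}
    (h : Function.Exact f g) (hA : IsArtinian R A) (hC : IsArtinian R C) : IsArtinian R B :=
  isArtinian_of_range_eq_ker f g (LinearMap.exact_iff.mp h).symm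

/-- After a first element `y₀` is chosen, `0 :_M y₀` is `𝔞`-torsion, so its higher local cohomology
vanishes and `Hⁱ(M) → Hⁱ(y₀M)` is onto. Then `Hⁱ(M/y₀M)` lies between `Hⁱ(M)` and `Hⁱ⁺¹(y₀M)`; it is
artinian in one degree fewer, and induction applies. -/
theorem exists_isFilterRegularSeq [IsNoetherianRing R] [Module.Finite R M] {𝔞 : Ideal R} {n : ℕ}
    (h : ∀ i < n, IsArtinian R (LimExt 𝔞 (ModuleCat.of R M) i)) :
    ∃ y : Fin n → R, (∀ j, y j ∈ 𝔞) ∧ IsFilterRegularSeq M y := by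
  induction n generalizing M with
  | zero => exact ⟨Fin.elim0, fun j => j.elim0, fun j => j.elim0⟩
  | succ n ih =>
    obtain ⟨y₀, hy₀, hreg, hle⟩ := exists_isFilterRegular (M := M) (𝔞 := 𝔞)
      ((limExtZeroEquiv 𝔞 (ModuleCat.of R M)).isArtinian_iff.mp (h 0 n.succ_pos))
    have hT : gamma 𝔞 (Submodule.torsionBy R M y₀) = ⊤ := by
      refine Submodule.eq_top_iff'.mpr fun m => ?_
      obtain ⟨k, hk⟩ := hle m.2
      exact ⟨k, fun c hc => Subtype.ext (hk c hc)⟩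
    have hP : ∀ i < n + 1, IsArtinian R
        (LimExt 𝔞 (ModuleCat.of R (Ideal.span {y₀} • (⊤ : Submodule R M) : Submodule R M)) i) := by
      intro i hi
      have := subsingleton_limExt_succ_of_torsion 𝔞
        (ModuleCat.of R (Submodule.torsionBy R M y₀)) hT i
      exact isArtinian_of_exact (limExt_exact₃ 𝔞 (shortExact_torsionBy M y₀) i) (h i hi)
        (show IsArtinian R (LimExt 𝔞 (ModuleCat.of R (Submodule.torsionBy R M y₀)) (i + 1)) from
          inferInstance)
    obtain ⟨y, hy, hyreg⟩ := ih (M := M ⧸ (Ideal.span {y₀} • (⊤ : Submodule R M))) fun i hi =>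
      isArtinian_of_exact (limExt_exact₃ 𝔞 (shortExact_smul_top M y₀) i) (h i (by lia))
        (hP (i + 1) (by lia))
    refine ⟨Fin.cons y₀ y, Fin.cases hy₀ hy, (isFilterRegularSeq_succ_iff _).mpr ⟨hreg, ?_⟩⟩
    exact hyreg

end FilterRegular

end ArtCof

end

/-! ### The equivalences -/

theorem theorem2p9 {R : Type u} [CommRing R] [IsNoetherianRing R]
    {r : ℕ} (x : Fin r → R) (𝔞 : Ideal R) (h𝔞 : 𝔞 = Ideal.span (Set.range x))
    (n : ℕ) (hn : 1 ≤ n) (M : Type u) [AddCommGroup M] [Module R M] :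
    List.TFAE [
      ∀ i < n, IsArtinian R ((localCohomology 𝔞 i).obj (ModuleCat.of R M)) ∧
        ArtCof.IsCofinite 𝔞 ((localCohomology 𝔞 i).obj (ModuleCat.of R M)),
      ∀ i < n, IsFiniteLength R (ArtCof.ExtQuot 𝔞 M i),
      ∀ i < n, IsFiniteLength R (ArtCof.koszulCohomology x M i)] ∧
    (Module.Finite R M → List.TFAE [
      ∀ i < n, IsArtinian R ((localCohomology 𝔞 i).obj (ModuleCat.of R M)) ∧
        ArtCof.IsCofinite 𝔞 ((localCohomology 𝔞 i).obj (ModuleCat.of R M)),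
      ∀ i < n, IsFiniteLength R (ArtCof.ExtQuot 𝔞 M i),
      ∀ i < n, IsFiniteLength R (ArtCof.koszulCohomology x M i),
      ∀ i < n, IsArtinian R ((localCohomology 𝔞 i).obj (ModuleCat.of R M)),
      ∃ y : Fin n → R, (∀ j, y j ∈ 𝔞) ∧ ArtCof.IsFilterRegularSeq M y]) := by
  have h12 : (∀ i < n, IsArtinian R ((localCohomology 𝔞 i).obj (ModuleCat.of R M)) ∧
      ArtCof.IsCofinite 𝔞 ((localCohomology 𝔞 i).obj (ModuleCat.of R M))) ↔
      ∀ i < n, IsFiniteLength R (ArtCof.ExtQuot 𝔞 M i) :=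
    (forall₂_congr fun i _ => ArtCof.isArtinian_and_isCofinite_congr
      (ArtCof.localCohomologyEquiv 𝔞 (ModuleCat.of R M) i)).trans
      ((ArtCof.devissage_limExt 𝔞).forall_lt_iff (ArtCof.devissage_ext 𝔞) n (ModuleCat.of R M))
  have h23 : (∀ i < n, IsFiniteLength R (ArtCof.ExtQuot 𝔞 M i)) ↔
      ∀ i < n, IsFiniteLength R (ArtCof.koszulCohomology x M i) := by
    subst h𝔞
    exact (ArtCof.devissage_ext _).forall_lt_iff (ArtCof.devissage_koszulCohomology x) n
      (ModuleCat.of R M)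
  refine ⟨?_, fun hM => ?_⟩
  · tfae_have 1 ↔ 2 := h12
    tfae_have 2 ↔ 3 := h23
    tfae_finish
  · tfae_have 1 ↔ 2 := h12
    tfae_have 2 ↔ 3 := h23
    tfae_have 1 → 4 := fun h i hi => (h i hi).1
    tfae_have 4 → 5 := fun h => ArtCof.exists_isFilterRegularSeq fun i hi =>
      (ArtCof.localCohomologyEquiv 𝔞 (ModuleCat.of R M) i).isArtinian_iff.mp (h i hi)
    tfae_have 5 → 2 := fun ⟨y, hy, h⟩ =>
      ArtCof.isFiniteLength_extQuot_of_isFilterRegularSeq y hy h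
    tfae_finish
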